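/- Let $T=(V,E)$ be a finite tree with leaf set $\delta\Omega$ (the vertices with exactly one neighbour). A real number $\lambda\ge 0$ is a Steklov eigenvalue of $T$ if there is a function $f\colon V\to\mathbb R$, not identically zero, such that $\sum_{w\sim v}(f(v)-f(w))=0$ for every $v\in V\setminus\delta\Omega$ and $f(\omega)-f(\omega')=\lambda f(\omega)$ for every leaf $\omega\in\delta\Omega$ with neighbour $\omega'$. Let $\lambda_2(T)$ be the smallest positive Steklov eigenvalue of $T$. A spider $S(\ell_1,\dots,\ell_b)$, with all $\ell_i\ge1$, is the tree obtained by gluing together one endpoint of each of $b$ paths of lengths $\ell_1,\dots,\ell_b$. A double spider $\mathrm{DS}(a_1,\dots,a_p;b_1,\dots,b_q)$, where $p,q\ge1$, $a_1\ge\cdots\ge a_p\ge1$ and $b_1\ge\cdots\ge b_q\ge1$, is the tree obtained from an edge $uv$ by attaching $p$ internally disjoint paths of lengths $a_1,\dots,a_p$ at $u$ and $q$ internally disjoint paths of lengths $b_1,\dots,b_q$ at $v$. **Theorem.** Let $D=2r+1\ge3$ be odd and let $n\ge D+1$. 1. For every tree $T$ of order $n$ and diameter $D$ there is a double spider $\mathrm{DS}(a_1,\dots,a_p;b_1,\dots,b_q)$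 of order $n$ and diameter $D$ such that $a_1=b_1=r$, every $a_i$ and every $b_j$ is at most $r$, and $$\lambda_2(T)\le\lambda_2\bigl(\mathrm{DS}(a_1,\dots,a_p;b_1,\dots,b_q)\bigr);$$ moreover, if equality holds for this double spider, then $T$ itself is (isomorphic to) a double spider. 2. Every double spider that maximizes $\lambda_2$ among the double spiders of order $n$ and diameter $D$ is (isomorphic to) a spider. 3. Every tree that maximizes $\lambda_2$ among all trees of order $n$ and diameter $D$ is (isomorphic to) a spider. -/

import Mathlib

/-- A leaf (boundary vertex) of a graph: a vertex with exactly one neighbour. -/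
def IsLeaf {V : Type*} (G : SimpleGraph V) (v : V) : Prop :=
  ∃! w, G.Adj v w

open Classical in
/-- The discrete Laplacian `Δ f (v) = ∑_{w ∼ v} (f v - f w)`. -/
noncomputable def graphLaplacian {V : Type*} [Fintype V] (G : SimpleGraph V)
    (f : V → ℝ) (v : V) : ℝ :=
  ∑ w ∈ Finset.univ.filter (fun w => G.Adj v w), (f v - f w)

/-- `μ` is a Steklov eigenvalue of `G` with the leaf set as boundary: `μ ≥ 0` and there is a
nonzero function that is harmonic at every non-leaf vertex and whose outward normal derivative
`f ω - f ω'` at each leaf `ω` (with unique neighbour `ω'`) equals `μ * f ω`. -/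
def IsSteklovEigenvalue {V : Type*} [Fintype V] (G : SimpleGraph V) (μ : ℝ) : Prop :=
  0 ≤ μ ∧ ∃ f : V → ℝ, f ≠ 0 ∧
    (∀ v, ¬ IsLeaf G v → graphLaplacian G f v = 0) ∧
    (∀ ω ω', IsLeaf G ω → G.Adj ω ω' → f ω - f ω' = μ * f ω)

/-- `λ₂`, the first nonzero Steklov eigenvalue. On a finite tree with at least two vertices the
eigenvalue `0` is simple (the tree is connected), so this is the second entry of the ordered
spectrum; there the set below is finite and nonempty, so that the infimum is a minimum. -/
noncomputable def steklovLambda₂ {V : Type*} [Fintype V] (G : SimpleGraph V) : ℝ :=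
  sInf {μ : ℝ | 0 < μ ∧ IsSteklovEigenvalue G μ}

/-- Vertices of a spider with `b` legs of lengths `ℓ i`: `none` is the center, and
`some ⟨i, k⟩` is the vertex of the `i`-th leg at distance `k + 1` from the center. -/
abbrev SpiderVertex {b : ℕ} (ℓ : Fin b → ℕ) : Type :=
  Option (Σ i : Fin b, Fin (ℓ i))

/-- The edges of a spider, oriented away from the center. -/
def spiderStep {b : ℕ} (ℓ : Fin b → ℕ) : SpiderVertex ℓ → SpiderVertex ℓ → Prop
  | none, some ⟨_, k⟩ => (k : ℕ) = 0
  | some ⟨i, k⟩, some ⟨j, m⟩ => i = j ∧ (m : ℕ) = (k : ℕ) + 1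
  | _, none => False

/-- The spider `S(ℓ₁, …, ℓ_b)`: paths of lengths `ℓ i` glued at one common endpoint. -/
def spider {b : ℕ} (ℓ : Fin b → ℕ) : SimpleGraph (SpiderVertex ℓ) :=
  SimpleGraph.fromRel (spiderStep ℓ)

/-- The double spider `DS(a₁, …, a_p ; b₁, …, b_q)`: the two spiders `S(a)` and `S(b)`, whose
centers `u = inl none` and `v = inr none` are joined by one edge. -/
def doubleSpider {p q : ℕ} (a : Fin p → ℕ) (b : Fin q → ℕ) :
    SimpleGraph (SpiderVertex a ⊕ SpiderVertex b) :=
  SimpleGraph.sum (spider a) (spider b) ⊔ SimpleGraph.edge (Sum.inl none) (Sum.inr none)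

/-- Admissible arm lengths on one side of a double spider: `a₁ ≥ a₂ ≥ ⋯ ≥ a_p ≥ 1`. -/
def IsArmProfile {p : ℕ} (a : Fin p → ℕ) : Prop :=
  Antitone a ∧ ∀ i, 1 ≤ a i

/-- `G` is (isomorphic to) a spider. -/
def IsSpider {V : Type*} (G : SimpleGraph V) : Prop :=
  ∃ (b : ℕ) (ℓ : Fin b → ℕ), (∀ i, 1 ≤ ℓ i) ∧ Nonempty (G ≃g spider ℓ)

/-- `G` is (isomorphic to) a double spider, with at least one arm on each side. -/
def IsDoubleSpider {V : Type*} (G : SimpleGraph V) : Prop :=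
  ∃ (p q : ℕ) (a : Fin (p + 1) → ℕ) (b : Fin (q + 1) → ℕ),
    IsArmProfile a ∧ IsArmProfile b ∧ Nonempty (G ≃g doubleSpider a b)

/-! The Steklov problem dualises to charges carried by the leaves. On a tree, a charge `g` of total
mass zero has the potential `-½ ∑ d(·, x) g x`, whose Laplacian is `g`, and `1 / λ₂` is the maximum
of the energy `-½ ∑ d(x, y) g x g y` relative to `∑ g²`. Test charges therefore bound `λ₂` from
above (`IsTree.steklovLambda₂_le`), and upper bounds on the energy bound it from below
(`IsTree.inv_le_steklovLambda₂`).

Cut a tree of diameter `2r + 1` at the middle edge `uv` of a diametral path, with leaves `X` beyond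
`u`, `Y` beyond `v`, at depths `k` from their centre. Since `∑ g = 0`, the energy is `S²`, with `S`
the flux through `uv`, plus the sum over same-side pairs of `g x g y` times their Gromov product at
the centre (`IsTwoCentred.flowEnergy_eq`). The diagonal contributes `∑ k g²`; the off-diagonal
products are nonnegative and all vanish exactly when the tree does not branch away from `u` and `v`.
For a double spider with arm lengths `ℓ`, weighted Cauchy–Schwarz on each side shows that the
maximum is the root `μ` of the secular equation `IsSecularRoot`, attained by a charge positive on
`X` and negative on `Y`.

For domination, choose `ℓ ≤ k` with the correct total on each side, keeping one arm of length `r` on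
each. The optimal charge of that double spider, placed on the leaves of the given tree, has energy
at least `μ ∑ g²`, and strictly more if the tree branches.

An unbranched tree with a single leaf on one side of `uv` is a spider. If both sides have at least
two leaves, moving all arms of `v` except one of length `r` over to `u` lowers the secular root
(`IsSecularRoot.lt_of_transfer`), hence raises `λ₂`. So no tree other than a spider is extremal. -/

open Finset

/-! ### Geodesics in trees. -/

namespace SimpleGraph

variable {V : Type*} {G : SimpleGraph V}

theorem Connected.dist_le_succ_of_adj (hG : G.Connected) (u : V) {v w : V} (h : G.Adj v w) :
    G.dist u w ≤ G.dist u v + 1 := by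
  have h1 := hG.dist_triangle (u := u) (v := v) (w := w)
  rwa [dist_eq_one_iff_adj.mpr h] at h1

theorem Connected.exists_adj_dist_succ (hG : G.Connected) {u v : V} (h : v ≠ u) :
    ∃ w, G.Adj v w ∧ G.dist u w + 1 = G.dist u v := by
  obtain ⟨p, hp⟩ := hG.exists_walk_length_eq_dist v u
  cases p with
  | nil => exact absurd rfl h
  | @cons _ w _ hvw q =>
    refine ⟨w, hvw, le_antisymm ?_ (hG.dist_le_succ_of_adj u hvw.symm)⟩
    have := dist_le q
    rw [Walk.length_cons] at hp
    rw [dist_comm, dist_comm (u := u)]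
    omega

/-- Both neighbours extend to shortest walks from `u` to `v`; these are paths, hence equal, and so
are their penultimate vertices. -/
theorem IsTree.eq_of_adj_dist_succ (hG : G.IsTree) {u v w w' : V} (hw : G.Adj v w)
    (hw' : G.Adj v w') (hd : G.dist u w + 1 = G.dist u v) (hd' : G.dist u w' + 1 = G.dist u v) :
    w = w' := by
  obtain ⟨p, hp⟩ := hG.connected.exists_walk_length_eq_dist u w
  obtain ⟨q, hq⟩ := hG.connected.exists_walk_length_eq_dist u w'
  have hp' : (p.concat hw.symm).IsPath :=
    Walk.isPath_of_length_eq_dist _ (by rw [Walk.length_concat, hp, hd])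
  have hq' : (q.concat hw'.symm).IsPath :=
    Walk.isPath_of_length_eq_dist _ (by rw [Walk.length_concat, hq, hd'])
  have h := congrArg (fun p : G.Path u v => (p : G.Walk u v).penultimate)
    ((hG.isAcyclic.subsingleton_path _ _).elim ⟨_, hp'⟩ ⟨_, hq'⟩)
  simpa using h

theorem IsTree.dist_succ_of_adj_of_ne (hG : G.IsTree) {u v w w' : V} (hw : G.Adj v w)
    (hw' : G.Adj v w') (hd : G.dist u w + 1 = G.dist u v) (hne : w' ≠ w) :
    G.dist u w' = G.dist u v + 1 := by
  rcases hG.dist_eq_dist_add_one_of_adj u hw' with h | h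
  · exact absurd (hG.eq_of_adj_dist_succ hw' hw h.symm hd) hne
  · exact h

theorem Connected.exists_between (hG : G.Connected) {u x : V} :
    ∀ {k : ℕ}, k ≤ G.dist u x → ∃ w, G.dist u w = k ∧ k + G.dist w x = G.dist u x := by
  intro k hk
  induction k with
  | zero => exact ⟨u, by simp, by simp⟩
  | succ k ih =>
    obtain ⟨w, hw, hwx⟩ := ih (by omega)
    have hne : w ≠ x := by rintro rfl; simp at hwx; omega
    obtain ⟨w', ha, hd⟩ := hG.exists_adj_dist_succ hne
    rw [dist_comm (u := x), dist_comm (u := x)] at hd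
    have h1 := hG.dist_le_succ_of_adj u ha
    have h2 := hG.dist_triangle (u := u) (v := w') (w := x)
    exact ⟨w', by omega, by omega⟩

theorem IsTree.eq_of_between (hG : G.IsTree) {u x : V} :
    ∀ {w w' : V}, G.dist u w = G.dist u w' → G.dist u w + G.dist w x = G.dist u x →
      G.dist u w' + G.dist w' x = G.dist u x → w = w' := by
  suffices H : ∀ n, ∀ w w' : V, G.dist w x = n → G.dist u w = G.dist u w' →
      G.dist u w + G.dist w x = G.dist u x → G.dist u w' + G.dist w' x = G.dist u x → w = w' from
    fun {w w'} => H _ w w' rfl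
  intro n
  induction n with
  | zero =>
    intro w w' h0 h1 h2 h3
    have a := hG.connected.dist_eq_zero_iff.mp h0
    have b : w' = x := hG.connected.dist_eq_zero_iff.mp (by omega)
    rw [a, b]
  | succ n ih =>
    intro w w' h0 h1 h2 h3
    have hw : w ≠ x := by rintro rfl; simp at h0
    have hw' : w' ≠ x := by rintro rfl; simp at h3; omega
    obtain ⟨z, hz, hzd⟩ := hG.connected.exists_adj_dist_succ hw
    obtain ⟨z', hz', hzd'⟩ := hG.connected.exists_adj_dist_succ hw'
    rw [dist_comm (u := x), dist_comm (u := x)] at hzd hzd'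
    have h4 := hG.connected.dist_triangle (u := u) (v := z) (w := x)
    have h5 := hG.connected.dist_triangle (u := u) (v := z') (w := x)
    have h6 := hG.connected.dist_le_succ_of_adj u hz
    have h7 := hG.connected.dist_le_succ_of_adj u hz'
    obtain rfl := ih z z' (by omega) (by omega) (by omega) (by omega)
    exact hG.eq_of_adj_dist_succ hz.symm hz'.symm (u := u) (by omega) (by omega)

/-- The step from `y` back towards `w` is also the step back towards `x`; every other neighbour of
`y` is farther from `x`. -/
theorem IsTree.dist_succ_of_between (hG : G.IsTree) {x w y z : V} (hw : y ≠ w)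
    (hb : G.dist x w + G.dist w y = G.dist x y) (ha : G.Adj y z)
    (hd : G.dist w z = G.dist w y + 1) : G.dist x z = G.dist x y + 1 := by
  obtain ⟨y', hy', hyd⟩ := hG.connected.exists_adj_dist_succ hw
  have h1 := hG.connected.dist_triangle (u := x) (v := w) (w := y')
  have h2 := hG.connected.dist_le_succ_of_adj x hy'.symm
  exact hG.dist_succ_of_adj_of_ne hy' ha (by omega) (by rintro rfl; omega)

/-- A geodesic between the two sides of `uv` must cross that edge. The induction moves `y` away from
`v` one step at a time, each step also leading away from `x`. -/
theorem IsTree.dist_of_opposite (hG : G.IsTree) {u v x : V} (huv : G.Adj u v)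
    (hx : G.dist x u < G.dist x v) :
    ∀ {y : V}, G.dist y v < G.dist y u → G.dist x y = G.dist x u + 1 + G.dist v y := by
  suffices H : ∀ n, ∀ y : V, G.dist v y = n → G.dist y v < G.dist y u →
      G.dist x y = G.dist x u + 1 + G.dist v y from fun {y} => H _ y rfl
  have hxv : G.dist x v = G.dist x u + 1 :=
    le_antisymm (hG.connected.dist_le_succ_of_adj x huv) hx
  intro n
  induction n with
  | zero =>
    intro y h0 _
    obtain rfl := hG.connected.dist_eq_zero_iff.mp h0
    simp [hxv]
  | succ n ih =>
    intro y h0 hy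
    have hne : y ≠ v := by rintro rfl; simp at h0
    obtain ⟨y', ha, hd⟩ := hG.connected.exists_adj_dist_succ hne
    have h1 := hG.connected.dist_le_succ_of_adj u ha.symm
    rw [dist_comm, dist_comm (v := u)] at hy
    have h2 := ih y' (by omega) (by rw [dist_comm, dist_comm (v := u)]; omega)
    by_cases hv : y' = v
    · subst hv
      have := hG.dist_succ_of_adj_of_ne huv.symm ha.symm (u := x) (by omega)
        (by rintro rfl; simp at hy)
      simp at hd
      omega
    · have := hG.dist_succ_of_between (x := x) (w := v) (z := y) hv (by omega) ha.symm (by omega)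
      omega

theorem IsTree.dist_lt_or_lt (hG : G.IsTree) {u v : V} (huv : G.Adj u v) (x : V) :
    G.dist x u < G.dist x v ∨ G.dist x v < G.dist x u := by
  have := hG.dist_ne_of_adj x huv
  omega

theorem not_isLeaf_of_adj_of_adj {x y z : V} (hy : G.Adj x y) (hz : G.Adj x z) (h : y ≠ z) :
    ¬ IsLeaf G x := fun hl => h (hl.unique hy hz)

theorem IsTree.exists_adj_dist_of_not_isLeaf (hG : G.IsTree) {u x : V} (hx : ¬ IsLeaf G x)
    (hne : x ≠ u) : ∃ y, G.Adj x y ∧ G.dist u y = G.dist u x + 1 := by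
  obtain ⟨w, hw, hd⟩ := hG.connected.exists_adj_dist_succ hne
  by_contra! hcon
  refine hx ⟨w, hw, fun y hy => ?_⟩
  by_contra hyw
  exact hcon y hy (hG.dist_succ_of_adj_of_ne hw hy hd hyw)

/-- Among the vertices reached from `u` through `w`, one farthest from `u` is a leaf, since from a
non-leaf the geodesic could be prolonged. -/
theorem IsTree.exists_isLeaf_between [Finite V] (hG : G.IsTree) {u w : V} (hw : w ≠ u) :
    ∃ x, IsLeaf G x ∧ G.dist u w + G.dist w x = G.dist u x := by
  obtain ⟨x, hx, hmax⟩ := Set.exists_max_image {x | G.dist u w + G.dist w x = G.dist u x}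
    (fun x => G.dist u x) (Set.toFinite _) ⟨w, by simp⟩
  refine ⟨x, ?_, hx⟩
  by_contra hl
  simp only [Set.mem_ofPred_eq] at hx hmax
  have hpos := hG.connected.pos_dist_of_ne hw.symm
  have hne : x ≠ u := by rintro rfl; rw [dist_self] at hx; omega
  obtain ⟨y, hy, hd⟩ := hG.exists_adj_dist_of_not_isLeaf hl hne
  have h1 := hG.connected.dist_triangle (u := u) (v := w) (w := y)
  have h2 := hG.connected.dist_le_succ_of_adj w hy
  have := hmax y (by omega)
  omega

theorem Connected.not_isLeaf_of_between (hG : G.Connected) {u w x : V} (hu : w ≠ u) (hx : w ≠ x)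
    (hb : G.dist u w + G.dist w x = G.dist u x) : ¬ IsLeaf G w := by
  obtain ⟨y, hy, hyd⟩ := hG.exists_adj_dist_succ hu
  obtain ⟨z, hz, hzd⟩ := hG.exists_adj_dist_succ hx
  refine not_isLeaf_of_adj_of_adj hy hz ?_
  rintro rfl
  have := hG.dist_triangle (u := u) (v := y) (w := x)
  rw [dist_comm (u := x), dist_comm (u := x)] at hzd
  omega

theorem IsTree.isLeaf_of_dist_eq_diam [Finite V] (hG : G.IsTree) {x y : V} (hne : x ≠ y)
    (h : G.dist x y = G.diam) : IsLeaf G x := by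
  by_contra hl
  obtain ⟨z, _, hz⟩ := hG.exists_adj_dist_of_not_isLeaf hl hne
  have : Nonempty V := ⟨x⟩
  have := dist_le_diam (connected_iff_ediam_ne_top.mp hG.connected) (u := y) (v := z)
  rw [dist_comm] at h
  omega

end SimpleGraph

/-! ### Potentials, flow energy and the variational principle for `λ₂`. -/

namespace SimpleGraph

section Potential

variable {V : Type*} [Fintype V] {G : SimpleGraph V}

/-- The potential `-½ ∑ₓ d(·, x) g x` of a charge `g`. On a tree it solves `Δ φ = g` as soon as
`g` has total mass zero. -/
noncomputable def potential (G : SimpleGraph V) (g : V → ℝ) (v : V) : ℝ :=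
  -(1 / 2) * ∑ x, (G.dist v x : ℝ) * g x

/-- The energy of the flow with divergence `g`. -/
noncomputable def flowEnergy (G : SimpleGraph V) (g : V → ℝ) : ℝ :=
  ∑ v, g v * potential G g v

/-- Charges carried by the leaves, of total mass zero. -/
def IsLeafCharge (G : SimpleGraph V) (g : V → ℝ) : Prop :=
  (∀ v, ¬ IsLeaf G v → g v = 0) ∧ ∑ v, g v = 0

theorem graphLaplacian_symm (f h : V → ℝ) :
    ∑ v, graphLaplacian G f v * h v = ∑ v, f v * graphLaplacian G h v := by
  classical
  have key : ∀ f h : V → ℝ, ∑ v, graphLaplacian G f v * h v =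
      ∑ v, ∑ w, (if G.Adj v w then f v * h v else 0) -
        ∑ v, ∑ w, (if G.Adj v w then f w * h v else 0) := by
    intro f h
    rw [← sum_sub_distrib]
    refine sum_congr rfl fun v _ => ?_
    rw [graphLaplacian, sum_mul, sum_filter, ← sum_sub_distrib]
    refine sum_congr rfl fun w _ => ?_
    split_ifs <;> ring
  have h2 : ∑ v, f v * graphLaplacian G h v = ∑ v, graphLaplacian G h v * f v :=
    sum_congr rfl fun v _ => mul_comm _ _
  rw [h2, key, key]
  congr 1
  · simp_rw [mul_comm]
  · rw [sum_comm]
    refine sum_congr rfl fun v _ => sum_congr rfl fun w _ => ?_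
    simp only [G.adj_comm w v, mul_comm]

theorem sum_graphLaplacian (f : V → ℝ) : ∑ v, graphLaplacian G f v = 0 := by
  have := graphLaplacian_symm (G := G) f 1
  simpa [graphLaplacian] using this

theorem graphLaplacian_of_isLeaf (f : V → ℝ) {ω ω' : V} (hl : IsLeaf G ω) (ha : G.Adj ω ω') :
    graphLaplacian G f ω = f ω - f ω' := by
  classical
  have : univ.filter (fun w => G.Adj ω w) = {ω'} := by
    ext w
    simp only [mem_filter, mem_univ, true_and, mem_singleton]
    exact ⟨fun h => hl.unique h ha, fun h => h ▸ ha⟩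
  rw [graphLaplacian]
  calc _ = ∑ w ∈ {ω'}, (f ω - f w) := sum_congr (by convert this) fun _ _ => rfl
    _ = _ := sum_singleton _ _

-- Measured from `v` itself, every neighbour is one step farther. Measured from `x ≠ v`, the same
-- holds except for the unique neighbour towards `x`, whose contribution changes from `-1` to `1`.
open Classical in
theorem IsTree.graphLaplacian_dist (hG : G.IsTree) (x v : V) :
    graphLaplacian G (fun w => (G.dist w x : ℝ)) v =
      graphLaplacian G (fun w => (G.dist w v : ℝ)) v + 2 - if v = x then 2 else 0 := by
  classical
  have h0 : ∀ w, G.Adj v w → (G.dist v v : ℝ) - G.dist w v = -1 := by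
    intro w hw
    rw [dist_self, dist_comm, dist_eq_one_iff_adj.mpr hw]; simp
  split_ifs with h
  · subst h; ring
  · obtain ⟨w0, hw0, hd⟩ := hG.connected.exists_adj_dist_succ h
    have h1 : ∀ w, G.Adj v w → (G.dist v x : ℝ) - G.dist w x =
        ((G.dist v v : ℝ) - G.dist w v) + if w = w0 then 2 else 0 := by
      intro w hw
      rw [h0 w hw, dist_comm (u := v), dist_comm (u := w)]
      split_ifs with hww
      · rw [hww, ← hd]; push_cast; ring
      · rw [hG.dist_succ_of_adj_of_ne hw0 hw hd hww]; push_cast; ring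
    simp only [graphLaplacian]
    rw [sum_congr rfl (fun w hw => h1 w (mem_filter.mp hw).2), sum_add_distrib]
    simp [hw0]

/-- The Laplacian of `d(·, x)` at `v` depends on `x` only through a term `-2` at `x = v`; the rest
is multiplied by the total mass zero. -/
theorem IsTree.graphLaplacian_potential (hG : G.IsTree) {g : V → ℝ} (hg : ∑ v, g v = 0) (v : V) :
    graphLaplacian G (potential G g) v = g v := by
  classical
  have h1 : graphLaplacian G (potential G g) v =
      -(1 / 2) * ∑ x, graphLaplacian G (fun w => (G.dist w x : ℝ)) v * g x := by
    have h2 : ∑ x, graphLaplacian G (fun w => (G.dist w x : ℝ)) v * g x =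
        ∑ w ∈ univ.filter (fun w => G.Adj v w),
          ∑ x, ((G.dist v x : ℝ) - G.dist w x) * g x := by
      simp only [graphLaplacian, sum_mul]
      rw [sum_comm]
    rw [h2, mul_sum]
    refine sum_congr rfl fun w _ => ?_
    simp only [potential, sub_mul, sum_sub_distrib]
    ring
  have h3 : ∑ x, graphLaplacian G (fun w => (G.dist w x : ℝ)) v * g x =
      ∑ x, ((graphLaplacian G (fun w => (G.dist w v : ℝ)) v + 2) * g x -
        if v = x then 2 * g x else 0) := by
    refine sum_congr rfl fun x _ => ?_
    rw [hG.graphLaplacian_dist x v]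
    split_ifs <;> ring
  rw [h1, h3, sum_sub_distrib, ← mul_sum, hg, sum_ite_eq, if_pos (mem_univ v)]
  ring

/-- Self-adjointness against the potential of the dipole `δ_x - δ_y` reads off `f x - f y`. -/
theorem IsTree.eq_const_of_graphLaplacian_eq_zero (hG : G.IsTree) {f : V → ℝ}
    (hf : ∀ v, graphLaplacian G f v = 0) (x y : V) : f x = f y := by
  classical
  by_cases hxy : x = y
  · rw [hxy]
  have hg : ∑ v, (Pi.single x (1 : ℝ) - Pi.single y (1 : ℝ) : V → ℝ) v = 0 := by
    simp [sum_sub_distrib]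
  have h := graphLaplacian_symm (G := G) f
    (potential G (Pi.single x (1 : ℝ) - Pi.single y (1 : ℝ)))
  simp only [hf, zero_mul, sum_const_zero, hG.graphLaplacian_potential hg] at h
  simp only [Pi.sub_apply, mul_sub, sum_sub_distrib, Pi.single_apply, mul_ite, mul_one, mul_zero,
    sum_ite_eq', mem_univ, if_true] at h
  linarith

theorem potential_add (g h : V → ℝ) (v : V) :
    potential G (g + h) v = potential G g v + potential G h v := by
  simp only [potential, Pi.add_apply, mul_add, sum_add_distrib]

theorem potential_smul (c : ℝ) (g : V → ℝ) (v : V) :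
    potential G (c • g) v = c * potential G g v := by
  simp only [potential, Pi.smul_apply, smul_eq_mul, mul_left_comm, mul_sum]

theorem sum_mul_potential_comm (g h : V → ℝ) :
    ∑ v, g v * potential G h v = ∑ v, h v * potential G g v := by
  simp only [potential, mul_sum]
  rw [sum_comm]
  refine sum_congr rfl fun v _ => sum_congr rfl fun w _ => ?_
  rw [G.dist_comm]; ring

theorem flowEnergy_add_smul (g h : V → ℝ) (t : ℝ) :
    flowEnergy G (g + t • h) =
      flowEnergy G g + 2 * t * (∑ v, h v * potential G g v) + t ^ 2 * flowEnergy G h := by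
  have := sum_mul_potential_comm (G := G) g h
  simp only [flowEnergy, Pi.add_apply, potential_add, potential_smul, Pi.smul_apply, smul_eq_mul]
  simp only [add_mul, mul_add, sum_add_distrib]
  simp only [mul_left_comm _ t, mul_assoc t, ← mul_sum]
  rw [this]; ring

theorem flowEnergy_smul (g : V → ℝ) (t : ℝ) : flowEnergy G (t • g) = t ^ 2 * flowEnergy G g := by
  simp only [flowEnergy, potential_smul, Pi.smul_apply, smul_eq_mul, mul_sum]
  exact sum_congr rfl fun v _ => by ring

theorem continuous_flowEnergy : Continuous (flowEnergy G) := by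
  unfold flowEnergy potential
  fun_prop

theorem IsLeafCharge.add_smul {g h : V → ℝ} (hg : IsLeafCharge G g) (hh : IsLeafCharge G h)
    (t : ℝ) : IsLeafCharge G (g + t • h) := by
  refine ⟨fun v hv => by simp [hg.1 v hv, hh.1 v hv], ?_⟩
  simp [sum_add_distrib, ← mul_sum, hg.2, hh.2]

theorem IsLeafCharge.smul {g : V → ℝ} (hg : IsLeafCharge G g) (t : ℝ) :
    IsLeafCharge G (t • g) := by
  refine ⟨fun v hv => by simp [hg.1 v hv], ?_⟩
  simp [← mul_sum, hg.2]

theorem sum_sq_pos {k : V → ℝ} (hk : k ≠ 0) : 0 < ∑ v, k v ^ 2 := by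
  obtain ⟨v, hv⟩ := Function.ne_iff.mp hk
  exact sum_pos' (fun v _ => sq_nonneg _) ⟨v, mem_univ v, sq_pos_iff.mpr hv⟩

theorem linear_coeff_eq_zero {b c : ℝ} (h : ∀ t : ℝ, 0 ≤ 2 * t * b + t ^ 2 * c) : b = 0 := by
  by_contra hb
  have h1 := h (-b / (|c| + 1))
  have hc : 0 < |c| + 1 := by positivity
  have h2 : 2 * (-b / (|c| + 1)) * b + (-b / (|c| + 1)) ^ 2 * c =
      b ^ 2 * (c - 2 * (|c| + 1)) / (|c| + 1) ^ 2 := by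
    field_simp
    ring
  rw [h2] at h1
  have h3 : b ^ 2 * (c - 2 * (|c| + 1)) < 0 :=
    mul_neg_of_pos_of_neg (by positivity) (by linarith [le_abs_self c, abs_nonneg c])
  have : b ^ 2 * (c - 2 * (|c| + 1)) / (|c| + 1) ^ 2 < 0 := div_neg_of_neg_of_pos h3 (by positivity)
  linarith

/-- The extremal leaf charge for the Rayleigh quotient. -/
theorem exists_max_flowEnergy {g : V → ℝ} (hg : IsLeafCharge G g) (hg0 : g ≠ 0) :
    ∃ h : V → ℝ, IsLeafCharge G h ∧ ∑ v, h v ^ 2 = 1 ∧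
      ∀ k, IsLeafCharge G k → flowEnergy G k ≤ flowEnergy G h * ∑ v, k v ^ 2 := by
  have hpos : ∀ k : V → ℝ, k ≠ 0 → 0 < ∑ v, k v ^ 2 := fun k hk => sum_sq_pos hk
  have hnorm : ∀ k : V → ℝ, IsLeafCharge G k → k ≠ 0 →
      IsLeafCharge G ((√(∑ v, k v ^ 2))⁻¹ • k) ∧
        ∑ v, ((√(∑ v, k v ^ 2))⁻¹ • k) v ^ 2 = 1 := by
    intro k hk hk0
    refine ⟨hk.smul _, ?_⟩
    simp only [Pi.smul_apply, smul_eq_mul, mul_pow, ← mul_sum, inv_pow]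
    rw [Real.sq_sqrt (hpos k hk0).le, inv_mul_cancel₀ (hpos k hk0).ne']
  have hcomp : IsCompact {k : V → ℝ | IsLeafCharge G k ∧ ∑ v, k v ^ 2 = 1} := by
    refine (isCompact_univ_pi (fun _ : V => isCompact_Icc (a := (-1 : ℝ)) (b := 1))).of_isClosed_subset
      ?_ ?_
    · have h1 : IsClosed {k : V → ℝ | ∀ v, ¬ IsLeaf G v → k v = 0} := by
        simp only [Set.ofPred_forall]
        exact isClosed_iInter fun v => isClosed_iInter fun _ =>
          isClosed_eq (continuous_apply v) continuous_const
      have h2 : IsClosed {k : V → ℝ | ∑ v, k v = 0} := isClosed_eq (by fun_prop) continuous_const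
      have h3 : IsClosed {k : V → ℝ | ∑ v, k v ^ 2 = 1} :=
        isClosed_eq (by fun_prop) continuous_const
      exact (h1.inter h2).inter h3
    · rintro k ⟨-, hk⟩ v -
      have : k v ^ 2 ≤ ∑ v, k v ^ 2 :=
        single_le_sum (f := fun v => k v ^ 2) (fun v _ => sq_nonneg _) (mem_univ v)
      exact ⟨by nlinarith, by nlinarith⟩
  obtain ⟨h, hh, hmax⟩ := hcomp.exists_isMaxOn ⟨_, hnorm g hg hg0⟩ continuous_flowEnergy.continuousOn
  refine ⟨h, hh.1, hh.2, fun k hk => ?_⟩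
  by_cases hk0 : k = 0
  · subst hk0; simp [flowEnergy]
  have h1 : flowEnergy G ((√(∑ v, k v ^ 2))⁻¹ • k) ≤ flowEnergy G h := hmax (hnorm k hk hk0)
  rw [flowEnergy_smul, inv_pow, Real.sq_sqrt (hpos k hk0).le] at h1
  rwa [inv_mul_le_iff₀ (hpos k hk0), mul_comm] at h1

/-- The first variation makes `M h - potential G h` orthogonal to every leaf charge; testing with
dipoles, it equals a constant `c` on the leaves. Then `potential G h + c` has Laplacian `h`
everywhere and equals `M h` on the leaves, which is the Steklov condition for `1 / M`. -/
theorem IsTree.isSteklovEigenvalue_of_max (hG : G.IsTree) {h : V → ℝ} (hh : IsLeafCharge G h)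
    (h1 : ∑ v, h v ^ 2 = 1) (hpos : 0 < flowEnergy G h)
    (hmax : ∀ k, IsLeafCharge G k → flowEnergy G k ≤ flowEnergy G h * ∑ v, k v ^ 2) :
    IsSteklovEigenvalue G (flowEnergy G h)⁻¹ := by
  classical
  set M := flowEnergy G h with hM
  have hlin : ∀ k, IsLeafCharge G k → ∑ v, k v * (M * h v - potential G h v) = 0 := by
    intro k hk
    apply linear_coeff_eq_zero (c := M * ∑ v, k v ^ 2 - flowEnergy G k)
    intro t
    have h2 := hmax _ (hh.add_smul hk t)
    rw [flowEnergy_add_smul, ← hM] at h2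
    have h3 : ∑ v, (h + t • k) v ^ 2 = 1 + 2 * t * ∑ v, k v * h v + t ^ 2 * ∑ v, k v ^ 2 := by
      rw [← h1, mul_sum, mul_sum, ← sum_add_distrib, ← sum_add_distrib]
      exact sum_congr rfl fun v _ => by simp only [Pi.add_apply, Pi.smul_apply, smul_eq_mul]; ring
    rw [h3] at h2
    have h4 : ∑ v, k v * (M * h v - potential G h v) =
        M * ∑ v, k v * h v - ∑ v, k v * potential G h v := by
      rw [mul_sum, ← sum_sub_distrib]
      exact sum_congr rfl fun v _ => by ring
    rw [h4]; linarith
  have hh0 : h ≠ 0 := by rintro rfl; simp at h1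
  obtain ⟨x, hx⟩ := Function.ne_iff.mp hh0
  have hxl : IsLeaf G x := by_contra fun hl => hx (hh.1 x hl)
  set c := M * h x - potential G h x with hc
  have hconst : ∀ y, IsLeaf G y → M * h y = potential G h y + c := by
    intro y hy
    have h2 := hlin (Pi.single x (1 : ℝ) - Pi.single y (1 : ℝ)) ⟨fun v hv => by
      have h3 : v ≠ x := by rintro rfl; exact hv hxl
      have h4 : v ≠ y := by rintro rfl; exact hv hy
      simp [h3, h4], by simp [sum_sub_distrib]⟩
    simp only [Pi.sub_apply, sub_mul, sum_sub_distrib, Pi.single_apply, ite_mul, one_mul, zero_mul,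
      sum_ite_eq', mem_univ, if_true] at h2
    linarith
  refine ⟨by positivity, fun v => potential G h v + c, ?_, ?_, ?_⟩
  · intro hz
    have h2 := congrFun hz x
    simp only [Pi.zero_apply] at h2
    rw [← hconst x hxl] at h2
    exact (mul_ne_zero hpos.ne' hx) h2
  · intro v hv
    have h2 := hG.graphLaplacian_potential hh.2 v
    rw [hh.1 v hv] at h2
    simpa [graphLaplacian] using h2
  · intro ω ω' hl ha
    have h2 := hG.graphLaplacian_potential hh.2 ω
    rw [graphLaplacian_of_isLeaf _ hl ha] at h2
    have h3 : M⁻¹ * (potential G h ω + c) = h ω := by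
      rw [← hconst ω hl, inv_mul_cancel_left₀ hpos.ne']
    linarith

theorem IsTree.exists_steklovEigenvalue_le (hG : G.IsTree) {g : V → ℝ} (hg : IsLeafCharge G g)
    {μ : ℝ} (hμ : 0 < μ) (hle : μ * ∑ v, g v ^ 2 ≤ flowEnergy G g) (hg0 : g ≠ 0) :
    ∃ lam, 0 < lam ∧ lam ≤ μ⁻¹ ∧ IsSteklovEigenvalue G lam := by
  obtain ⟨h, hh, h1, hmax⟩ := exists_max_flowEnergy hg hg0
  have hs : 0 < ∑ v, g v ^ 2 := sum_sq_pos hg0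
  have h2 : μ ≤ flowEnergy G h := le_of_mul_le_mul_right (hle.trans (hmax g hg)) hs
  have h3 : 0 < flowEnergy G h := hμ.trans_le h2
  exact ⟨_, inv_pos.mpr h3, inv_anti₀ hμ h2, hG.isSteklovEigenvalue_of_max hh h1 h3 hmax⟩

theorem IsTree.steklovLambda₂_le (hG : G.IsTree) {g : V → ℝ} (hg : IsLeafCharge G g)
    {μ : ℝ} (hμ : 0 < μ) (hle : μ * ∑ v, g v ^ 2 ≤ flowEnergy G g) (hg0 : g ≠ 0) :
    steklovLambda₂ G ≤ μ⁻¹ := by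
  obtain ⟨l, h0, h1, h2⟩ := hG.exists_steklovEigenvalue_le hg hμ hle hg0
  exact (csInf_le (s := {μ : ℝ | 0 < μ ∧ IsSteklovEigenvalue G μ}) ⟨0, fun x hx => hx.1.le⟩
    ⟨h0, h2⟩).trans h1

/-- The Laplacian of an eigenfunction `f` is a leaf charge with energy `∑ f Δf` and squared norm
`lam * ∑ f Δf`, so the energy bound becomes `1 ≤ μ * lam`. -/
theorem IsTree.inv_le_of_isSteklovEigenvalue [Nontrivial V] (hG : G.IsTree) {μ : ℝ} (hμ : 0 < μ)
    (hmax : ∀ g, IsLeafCharge G g → flowEnergy G g ≤ μ * ∑ v, g v ^ 2) {lam : ℝ} (hlam : 0 < lam)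
    (h : IsSteklovEigenvalue G lam) : μ⁻¹ ≤ lam := by
  classical
  obtain ⟨-, f, hf0, hint, hbd⟩ := h
  have hleaf : ∀ v, IsLeaf G v → graphLaplacian G f v = lam * f v := fun v hv => by
    obtain ⟨w, hw, -⟩ := id hv
    rw [graphLaplacian_of_isLeaf f hv hw, hbd v w hv hw]
  have hcharge : IsLeafCharge G (graphLaplacian G f) := ⟨hint, sum_graphLaplacian f⟩
  have h1 : flowEnergy G (graphLaplacian G f) = ∑ v, f v * graphLaplacian G f v := by
    rw [flowEnergy, graphLaplacian_symm]
    simp_rw [hG.graphLaplacian_potential (sum_graphLaplacian f)]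
  have h2 : ∑ v, graphLaplacian G f v ^ 2 = lam * ∑ v, f v * graphLaplacian G f v := by
    rw [mul_sum]
    refine sum_congr rfl fun v _ => ?_
    by_cases hv : IsLeaf G v
    · rw [hleaf v hv]; ring
    · rw [hint v hv]; ring
  have h3 := hmax _ hcharge
  -- Otherwise `f` is a nonzero constant, contradicting the boundary condition at any leaf because
  -- `lam > 0`.
  have hne : graphLaplacian G f ≠ 0 := by
    intro hz
    have hconst := hG.eq_const_of_graphLaplacian_eq_zero (f := f) (congrFun hz)
    obtain ⟨x, hx⟩ := Function.ne_iff.mp hf0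
    obtain ⟨w, hw⟩ := exists_ne x
    obtain ⟨y, hy, -⟩ := hG.exists_isLeaf_between hw
    have h4 := hleaf y hy
    rw [congrFun hz y, hconst y x] at h4
    exact (mul_ne_zero hlam.ne' hx) h4.symm
  have hs : 0 < ∑ v, graphLaplacian G f v ^ 2 := sum_sq_pos hne
  rw [h1] at h3
  rw [h2] at hs h3
  have h4 : 0 < ∑ v, f v * graphLaplacian G f v := pos_of_mul_pos_right hs hlam.le
  rw [inv_le_iff_one_le_mul₀' hμ]
  have : 1 * ∑ v, f v * graphLaplacian G f v ≤ (μ * lam) * ∑ v, f v * graphLaplacian G f v := by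
    linarith
  exact le_of_mul_le_mul_right this h4

end Potential

end SimpleGraph

/-! ### The secular equation and two-centred trees. -/

namespace SimpleGraph

section ArmEnds

/-- The total conductance `∑ 1 / (μ - ℓ x)` of the arms `x ∈ X` of lengths `ℓ x` at spectral
parameter `1 / μ`. -/
noncomputable def conductance {ι : Type*} (X : Finset ι) (ℓ : ι → ℕ) (μ : ℝ) : ℝ :=
  ∑ x ∈ X, (μ - ℓ x)⁻¹

/-- The secular equation satisfied by `1 / λ₂` for the double spider with arms `X` and `Y`. -/
def IsSecularRoot {ι : Type*} (X Y : Finset ι) (ℓ : ι → ℕ) (μ : ℝ) : Prop :=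
  (∀ x ∈ X, (ℓ x : ℝ) < μ) ∧ (∀ y ∈ Y, (ℓ y : ℝ) < μ) ∧
    (conductance X ℓ μ)⁻¹ + (conductance Y ℓ μ)⁻¹ = 1

theorem conductance_pos {ι : Type*} {X : Finset ι} (hX : X.Nonempty) {ℓ : ι → ℕ} {μ : ℝ}
    (h : ∀ x ∈ X, (ℓ x : ℝ) < μ) : 0 < conductance X ℓ μ :=
  sum_pos (fun x hx => inv_pos.mpr (sub_pos.mpr (h x hx))) hX

/-- The distances between the arm ends of a tree with two centres. -/
structure IsTwoCentred {V : Type*} (G : SimpleGraph V) (X Y : Finset V) (k : V → ℕ) : Prop where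
  disjoint : Disjoint X Y
  nonempty_left : X.Nonempty
  nonempty_right : Y.Nonempty
  dist_left : ∀ x ∈ X, ∀ x' ∈ X, G.dist x x' ≤ k x + k x'
  dist_right : ∀ y ∈ Y, ∀ y' ∈ Y, G.dist y y' ≤ k y + k y'
  dist_cross : ∀ x ∈ X, ∀ y ∈ Y, G.dist x y = k x + 1 + k y

variable {V : Type*} {G : SimpleGraph V} {X Y : Finset V} {k ℓ : V → ℕ} {μ : ℝ}

theorem IsSecularRoot.pos (hμ : IsSecularRoot X Y ℓ μ) (hX : X.Nonempty) : 0 < μ := by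
  obtain ⟨x, hx⟩ := hX
  exact lt_of_le_of_lt (Nat.cast_nonneg _) (hμ.1 x hx)

theorem sum_sq_div_le_sum {g : V → ℝ} (hX : X.Nonempty) (hμ : ∀ x ∈ X, (ℓ x : ℝ) < μ) :
    (∑ x ∈ X, g x) ^ 2 * (conductance X ℓ μ)⁻¹ ≤ ∑ x ∈ X, (μ - ℓ x) * g x ^ 2 := by
  have hA := conductance_pos hX hμ
  rw [← div_eq_mul_inv, div_le_iff₀ hA, conductance]
  refine sum_sq_le_sum_mul_sum_of_sq_le_mul X ?_ ?_ ?_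
  · exact fun x hx => mul_nonneg (sub_pos.mpr (hμ x hx)).le (sq_nonneg _)
  · exact fun x hx => (inv_pos.mpr (sub_pos.mpr (hμ x hx))).le
  · intro x hx
    rw [mul_right_comm, mul_inv_cancel₀ (sub_pos.mpr (hμ x hx)).ne', one_mul]

-- Off the diagonal, `g x * g y` is positive on same-side pairs and the Gromov product is
-- nonnegative by the triangle inequality; on the diagonal that product is the depth `k x ≥ ℓ x`.
open Classical in
theorem IsTwoCentred.energy_term_le (h : IsTwoCentred G X Y k) (hℓ : ∀ v, v ∈ X ∨ v ∈ Y → ℓ v ≤ k v)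
    {g : V → ℝ} (hgX : ∀ x ∈ X, 0 < g x) (hgY : ∀ y ∈ Y, g y < 0)
    (hg0 : ∀ v, v ∉ X → v ∉ Y → g v = 0) (x y : V) :
    (if y = x then ℓ x * g x ^ 2 else 0) ≤ g x * g y *
      if (x ∈ X ∧ y ∈ X) ∨ (x ∈ Y ∧ y ∈ Y) then ((k x : ℝ) + k y - G.dist x y) / 2 else 0 := by
  split_ifs with hxy hc hc
  · subst hxy
    have : (ℓ y : ℝ) ≤ k y := by exact_mod_cast hℓ y (by tauto)
    rw [dist_self]
    have := mul_le_mul_of_nonneg_right this (sq_nonneg (g y))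
    push_cast
    linarith
  · have : g x = 0 := hg0 x (by rintro h; simp_all) (by rintro h; simp_all)
    simp [this]
  · have hd : (G.dist x y : ℝ) ≤ k x + k y := by
      rcases hc with hc | hc
      · exact_mod_cast h.dist_left x hc.1 y hc.2
      · exact_mod_cast h.dist_right x hc.1 y hc.2
    have hgg : 0 ≤ g x * g y := by
      rcases hc with hc | hc
      · exact (mul_pos (hgX x hc.1) (hgX y hc.2)).le
      · exact (mul_pos_of_neg_of_neg (hgY x hc.1) (hgY y hc.2)).le
    exact mul_nonneg hgg (by linarith)
  · simp

end ArmEnds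

/-! ### Comparison of `λ₂` with the secular root. -/

section Comparison

variable {V : Type*} [Fintype V] {G : SimpleGraph V}

/-- The parts of the distance that depend on only one of the two vertices are killed by the zero
total mass. -/
theorem flowEnergy_eq_sum_sum {g c : V → ℝ} {M : V → V → ℝ} (hg : ∑ v, g v = 0)
    (hM : ∀ x y, g x ≠ 0 → g y ≠ 0 → (G.dist x y : ℝ) = c x + c y - 2 * M x y) :
    flowEnergy G g = ∑ x, ∑ y, g x * g y * M x y := by
  have h1 : flowEnergy G g = ∑ x, ∑ y, g x * g y * (-(1 / 2) * (G.dist x y : ℝ)) := by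
    simp only [flowEnergy, potential, mul_sum]
    exact sum_congr rfl fun x _ => sum_congr rfl fun y _ => by ring
  have h2 : ∀ x y, g x * g y * (-(1 / 2) * (G.dist x y : ℝ)) =
      -(1 / 2) * (g x * c x) * g y + -(1 / 2) * g x * (g y * c y) + g x * g y * M x y := by
    intro x y
    by_cases hx : g x = 0
    · simp [hx]
    by_cases hy : g y = 0
    · simp [hy]
    rw [hM x y hx hy]; ring
  simp_rw [h1, h2, sum_add_distrib, ← mul_sum, hg, ← sum_mul, ← mul_sum, hg]
  simp

theorem IsTree.exists_isLeaf_ne [Nontrivial V] (hG : G.IsTree) :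
    ∃ x y, x ≠ y ∧ IsLeaf G x ∧ IsLeaf G y := by
  obtain ⟨a, b, hab⟩ := exists_pair_ne V
  obtain ⟨x, hx, h1⟩ := hG.exists_isLeaf_between hab
  obtain ⟨w, hw⟩ := exists_ne x
  obtain ⟨y, hy, h2⟩ := hG.exists_isLeaf_between hw
  refine ⟨x, y, ?_, hx, hy⟩
  rintro rfl
  rw [dist_self] at h2
  have := hG.connected.pos_dist_of_ne hw.symm
  omega

theorem IsTree.inv_le_steklovLambda₂ [Nontrivial V] (hG : G.IsTree) {μ : ℝ} (hμ : 0 < μ)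
    (hmax : ∀ g, IsLeafCharge G g → flowEnergy G g ≤ μ * ∑ v, g v ^ 2) :
    μ⁻¹ ≤ steklovLambda₂ G := by
  classical
  refine le_csInf ?_ fun lam h => hG.inv_le_of_isSteklovEigenvalue hμ hmax h.1 h.2
  -- The infimum of an empty set would be `0`, so a positive eigenvalue has to be produced; a dipole
  -- on two leaves has energy `d(x, y) > 0`.
  obtain ⟨x, y, hne, hx, hy⟩ := hG.exists_isLeaf_ne
  set g : V → ℝ := Pi.single x (1 : ℝ) - Pi.single y (1 : ℝ) with hgdef
  have hg : IsLeafCharge G g := ⟨fun v hv => by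
    have h3 : v ≠ x := by rintro rfl; exact hv hx
    have h4 : v ≠ y := by rintro rfl; exact hv hy
    simp [g, h3, h4], by simp [g, sum_sub_distrib]⟩
  have hgx : g x = 1 := by simp [g, hne]
  have hg0 : g ≠ 0 := fun h => by rw [h] at hgx; simp at hgx
  have hs := sum_sq_pos hg0
  have hE : flowEnergy G g = G.dist x y := by
    have h1 : ∀ f : V → ℝ, ∑ v, g v * f v = f x - f y := fun f => by
      simp [g, sub_mul, sum_sub_distrib, Pi.single_apply]
    have h2 : ∀ v, potential G g v = -(1 / 2) * (G.dist v x - G.dist v y) := fun v => by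
      rw [potential, ← h1 fun z => (G.dist v z : ℝ)]
      simp_rw [mul_comm]
    rw [flowEnergy, h1, h2, h2, dist_self, dist_self, G.dist_comm (u := y)]
    simp; ring
  have hd : (0 : ℝ) < G.dist x y := by exact_mod_cast hG.connected.pos_dist_of_ne hne
  obtain ⟨lam, h0, -, h1⟩ := hG.exists_steklovEigenvalue_le hg (div_pos hd hs)
    (by rw [div_mul_cancel₀ _ hs.ne', hE]) hg0
  exact ⟨lam, h0, h1⟩

theorem IsTree.steklovLambda₂_lt (hG : G.IsTree) {g : V → ℝ} (hg : IsLeafCharge G g)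
    {μ : ℝ} (hμ : 0 < μ) (hlt : μ * ∑ v, g v ^ 2 < flowEnergy G g) (hg0 : g ≠ 0) :
    steklovLambda₂ G < μ⁻¹ := by
  have hs := sum_sq_pos hg0
  have h1 : μ < flowEnergy G g / ∑ v, g v ^ 2 := (lt_div_iff₀ hs).mpr hlt
  refine (hG.steklovLambda₂_le hg (hμ.trans h1) ?_ hg0).trans_lt (inv_strictAnti₀ hμ h1)
  rw [div_mul_cancel₀ _ hs.ne']

variable {X Y : Finset V} {k ℓ : V → ℕ} {μ : ℝ}

-- Root the tree at the centre of `Y`. Then `c` is the depth, and `M` measures the overlap of two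
-- root paths: the central edge if both ends lie in `X`, plus the Gromov product at their common
-- centre.
open Classical in
theorem IsTwoCentred.flowEnergy_eq (h : IsTwoCentred G X Y k) {g : V → ℝ} (hg : ∑ v, g v = 0)
    (hsupp : ∀ v, v ∉ X → v ∉ Y → g v = 0) :
    flowEnergy G g = (∑ x ∈ X, g x) ^ 2 + ∑ x, ∑ y, g x * g y *
      if (x ∈ X ∧ y ∈ X) ∨ (x ∈ Y ∧ y ∈ Y) then ((k x : ℝ) + k y - G.dist x y) / 2 else 0 := by
  have hS : (∑ x ∈ X, g x) ^ 2 =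
      ∑ x, ∑ y, g x * g y * ((if x ∈ X then 1 else 0) * (if y ∈ X then 1 else 0)) := by
    have : ∑ x ∈ X, g x = ∑ x, g x * (if x ∈ X then 1 else 0) := by simp
    rw [sq, this, sum_mul_sum]
    exact sum_congr rfl fun x _ => sum_congr rfl fun y _ => by ring
  rw [hS, ← sum_add_distrib, flowEnergy_eq_sum_sum hg (c := fun x => k x + if x ∈ X then 1 else 0)
    (M := fun x y => (if x ∈ X then 1 else 0) * (if y ∈ X then 1 else 0) +
      if (x ∈ X ∧ y ∈ X) ∨ (x ∈ Y ∧ y ∈ Y) then ((k x : ℝ) + k y - G.dist x y) / 2 else 0)]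
  · refine sum_congr rfl fun x _ => ?_
    rw [← sum_add_distrib]
    exact sum_congr rfl fun y _ => by ring
  · intro x y hx hy
    have hx' : x ∈ X ∨ x ∈ Y := by by_contra! hc; exact hx (hsupp x hc.1 hc.2)
    have hy' : y ∈ X ∨ y ∈ Y := by by_contra! hc; exact hy (hsupp y hc.1 hc.2)
    have hXY : ∀ v ∈ Y, v ∉ X := fun v h1 h2 => Finset.disjoint_left.mp h.disjoint h2 h1
    have hYX : ∀ v ∈ X, v ∉ Y := fun v h1 h2 => Finset.disjoint_left.mp h.disjoint h1 h2
    rcases hx' with hx' | hx' <;> rcases hy' with hy' | hy'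
    · simp [hx', hy']; ring
    · simp [hx', hy', hXY y hy', hYX x hx', h.dist_cross x hx' y hy']
    · simp [hx', hy', hXY x hx', hYX y hy', G.dist_comm (u := x), h.dist_cross y hy' x hx']; ring
    · simp [hx', hy', hXY x hx', hXY y hy']; ring

theorem sum_eq_add_of_support {f : V → ℝ} (h : Disjoint X Y)
    (hsupp : ∀ v, v ∉ X → v ∉ Y → f v = 0) : ∑ v, f v = ∑ x ∈ X, f x + ∑ y ∈ Y, f y := by
  classical
  rw [← sum_union h]
  refine (sum_subset (subset_univ _) fun v _ hv => ?_).symm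
  rw [mem_union, not_or] at hv
  exact hsupp v hv.1 hv.2

/-- The lower bound on `λ₂` when paths between arm ends pass through the centres. -/
theorem IsTwoCentred.inv_le_steklovLambda₂ (hG : G.IsTree) (h : IsTwoCentred G X Y k)
    (hleaf : ∀ v, IsLeaf G v → v ∈ X ∨ v ∈ Y)
    (hX : ∀ x ∈ X, ∀ x' ∈ X, x ≠ x' → G.dist x x' = k x + k x')
    (hY : ∀ y ∈ Y, ∀ y' ∈ Y, y ≠ y' → G.dist y y' = k y + k y')
    (hμ : IsSecularRoot X Y k μ) : μ⁻¹ ≤ steklovLambda₂ G := by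
  classical
  obtain ⟨hμX, hμY, hroot⟩ := hμ
  obtain ⟨x0, hx0⟩ := h.nonempty_left
  obtain ⟨y0, hy0⟩ := h.nonempty_right
  have hμ0 : 0 < μ := lt_of_le_of_lt (Nat.cast_nonneg _) (hμX x0 hx0)
  have : Nontrivial V := ⟨x0, y0, by rintro rfl; exact Finset.disjoint_left.mp h.disjoint hx0 hy0⟩
  refine hG.inv_le_steklovLambda₂ hμ0 fun g hg => ?_
  have hsupp : ∀ v, v ∉ X → v ∉ Y → g v = 0 := fun v h1 h2 =>
    hg.1 v fun hl => (hleaf v hl).elim h1 h2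
  have hdiag : ∀ x, ∑ y, g x * g y * (if (x ∈ X ∧ y ∈ X) ∨ (x ∈ Y ∧ y ∈ Y) then
      ((k x : ℝ) + k y - G.dist x y) / 2 else 0) = k x * g x ^ 2 := by
    intro x
    rw [sum_eq_single_of_mem x (mem_univ x)]
    · by_cases hx : g x = 0
      · simp [hx]
      have hx' : x ∈ X ∨ x ∈ Y := by by_contra! hc; exact hx (hsupp x hc.1 hc.2)
      rw [if_pos (by simpa using hx'), dist_self]
      push_cast; ring
    · intro y _ hne
      split_ifs with hc
      · rcases hc with hc | hc
        · rw [hX x hc.1 y hc.2 hne.symm]; push_cast; ring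
        · rw [hY x hc.1 y hc.2 hne.symm]; push_cast; ring
      · simp
  rw [h.flowEnergy_eq hg.2 hsupp, sum_congr rfl fun x _ => hdiag x]
  have hsum := sum_eq_add_of_support h.disjoint hsupp
  rw [hg.2] at hsum
  have h1 : ∑ v, (μ - k v) * g v ^ 2 = ∑ x ∈ X, (μ - k x) * g x ^ 2 + ∑ y ∈ Y, (μ - k y) * g y ^ 2 :=
    sum_eq_add_of_support h.disjoint fun v h1 h2 => by simp [hsupp v h1 h2]
  have h2 := sum_sq_div_le_sum (g := g) h.nonempty_left hμX
  have h3 := sum_sq_div_le_sum (g := g) h.nonempty_right hμY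
  -- Both sides carry the same flux up to sign, so the secular equation adds the two Cauchy–Schwarz
  -- bounds up to exactly `S²`.
  have h4 : (∑ y ∈ Y, g y) ^ 2 = (∑ x ∈ X, g x) ^ 2 := by
    rw [show ∑ y ∈ Y, g y = -∑ x ∈ X, g x by linarith]; ring
  rw [h4] at h3
  have h5 : ∑ v, (μ - k v) * g v ^ 2 = μ * ∑ v, g v ^ 2 - ∑ v, k v * g v ^ 2 := by
    simp only [sub_mul, sum_sub_distrib, mul_sum]
  have h6 : (∑ x ∈ X, g x) ^ 2 * (conductance X k μ)⁻¹ +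
      (∑ x ∈ X, g x) ^ 2 * (conductance Y k μ)⁻¹ = (∑ x ∈ X, g x) ^ 2 := by
    rw [← mul_add, hroot, mul_one]
  linarith

/-- The charge of the `λ₂`-eigenfunction of the double spider with arms `X` and `Y`. -/
theorem exists_secular_charge (hd : Disjoint X Y) (hX : X.Nonempty) (hY : Y.Nonempty)
    (hμ : IsSecularRoot X Y ℓ μ) : ∃ g : V → ℝ, (∀ x ∈ X, 0 < g x) ∧ (∀ y ∈ Y, g y < 0) ∧
      (∀ v, v ∉ X → v ∉ Y → g v = 0) ∧ ∑ v, g v = 0 ∧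
      μ * ∑ v, g v ^ 2 = (∑ x ∈ X, g x) ^ 2 + ∑ v, ℓ v * g v ^ 2 := by
  classical
  obtain ⟨hμX, hμY, hroot⟩ := hμ
  have hA := conductance_pos hX hμX
  have hB := conductance_pos hY hμY
  set A := conductance X ℓ μ with hAdef
  set B := conductance Y ℓ μ with hBdef
  have hYX : ∀ v ∈ Y, v ∉ X := fun v h1 h2 => Finset.disjoint_left.mp hd h2 h1
  -- The equality case of Cauchy–Schwarz on each side, normalised to total charge `1` on `X` and
  -- `-1` on `Y`.
  let g : V → ℝ := fun v => if v ∈ X then A⁻¹ * (μ - ℓ v)⁻¹ else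
    if v ∈ Y then -(B⁻¹ * (μ - ℓ v)⁻¹) else 0
  have gX : ∀ x ∈ X, g x = A⁻¹ * (μ - ℓ x)⁻¹ := fun x hx => by simp [g, hx]
  have gY : ∀ y ∈ Y, g y = -(B⁻¹ * (μ - ℓ y)⁻¹) := fun y hy => by simp [g, hy, hYX y hy]
  have g0 : ∀ v, v ∉ X → v ∉ Y → g v = 0 := fun v h1 h2 => by simp [g, h1, h2]
  have sX : ∑ x ∈ X, g x = 1 := by
    rw [sum_congr rfl gX, ← mul_sum]
    exact inv_mul_cancel₀ hA.ne'
  have sY : ∑ y ∈ Y, g y = -1 := by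
    rw [sum_congr rfl gY, sum_neg_distrib, ← mul_sum]
    exact congrArg Neg.neg (inv_mul_cancel₀ hB.ne')
  have hpX : ∀ x ∈ X, 0 < (μ - ℓ x)⁻¹ := fun x hx => inv_pos.mpr (sub_pos.mpr (hμX x hx))
  have hpY : ∀ y ∈ Y, 0 < (μ - ℓ y)⁻¹ := fun y hy => inv_pos.mpr (sub_pos.mpr (hμY y hy))
  refine ⟨g, fun x hx => ?_, fun y hy => ?_, g0, ?_, ?_⟩
  · rw [gX x hx]; exact mul_pos (inv_pos.mpr hA) (hpX x hx)
  · rw [gY y hy]; exact neg_neg_of_pos (mul_pos (inv_pos.mpr hB) (hpY y hy))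
  · rw [sum_eq_add_of_support hd g0, sX, sY]; ring
  · have h1 : ∑ v, (μ - ℓ v) * g v ^ 2 = 1 := by
      rw [sum_eq_add_of_support hd fun v h1 h2 => by simp [g0 v h1 h2]]
      have e1 : ∑ x ∈ X, (μ - ℓ x) * g x ^ 2 = A⁻¹ := by
        calc _ = ∑ x ∈ X, A⁻¹ * g x := sum_congr rfl fun x hx => by
              have := (sub_pos.mpr (hμX x hx)).ne'
              rw [gX x hx]; field_simp
          _ = _ := by rw [← mul_sum, sX, mul_one]
      have e2 : ∑ y ∈ Y, (μ - ℓ y) * g y ^ 2 = B⁻¹ := by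
        calc _ = ∑ y ∈ Y, -B⁻¹ * g y := sum_congr rfl fun y hy => by
              have := (sub_pos.mpr (hμY y hy)).ne'
              rw [gY y hy]; field_simp
          _ = _ := by rw [← mul_sum, sY]; ring
      rw [e1, e2, hroot]
    simp only [sub_mul, sum_sub_distrib, ← mul_sum] at h1
    rw [sX]; linarith

/-- The optimal charge for the arm lengths `ℓ` serves as a test charge on `G`. Larger depths and
shared path segments only add energy; a shared segment adds a strictly positive amount. -/
theorem IsTwoCentred.exists_charge (h : IsTwoCentred G X Y k)
    (hleafX : ∀ x ∈ X, IsLeaf G x) (hleafY : ∀ y ∈ Y, IsLeaf G y)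
    (hℓ : ∀ v, v ∈ X ∨ v ∈ Y → ℓ v ≤ k v) (hμ : IsSecularRoot X Y ℓ μ) :
    ∃ g : V → ℝ, IsLeafCharge G g ∧ g ≠ 0 ∧ μ * ∑ v, g v ^ 2 ≤ flowEnergy G g ∧
      ((∃ x y, x ≠ y ∧ ((x ∈ X ∧ y ∈ X) ∨ (x ∈ Y ∧ y ∈ Y)) ∧ G.dist x y < k x + k y) →
        μ * ∑ v, g v ^ 2 < flowEnergy G g) := by
  classical
  obtain ⟨g, hgX, hgY, hg0, hsum, hE⟩ :=
    exists_secular_charge h.disjoint h.nonempty_left h.nonempty_right hμ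
  have hterm := h.energy_term_le hℓ hgX hgY hg0
  have hrow : ∀ x, ∑ y, (if y = x then ℓ x * g x ^ 2 else 0) = ℓ x * g x ^ 2 := fun x => by simp
  refine ⟨g, ⟨fun v hv => hg0 v (fun hx => hv (hleafX v hx)) fun hy => hv (hleafY v hy), hsum⟩,
    ?_, ?_, ?_⟩
  · obtain ⟨x, hx⟩ := h.nonempty_left
    exact fun h0 => (hgX x hx).ne' (congrFun h0 x)
  · rw [hE, h.flowEnergy_eq hsum hg0]
    refine add_le_add le_rfl (sum_le_sum fun x _ => ?_)
    rw [← hrow x]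
    exact sum_le_sum fun y _ => hterm x y
  · rintro ⟨x, y, hne, hc, hlt⟩
    rw [hE, h.flowEnergy_eq hsum hg0]
    refine add_lt_add_of_le_of_lt le_rfl (sum_lt_sum (fun x _ => ?_) ⟨x, mem_univ x, ?_⟩)
    · rw [← hrow x]
      exact sum_le_sum fun y _ => hterm x y
    · rw [← hrow x]
      refine sum_lt_sum (fun y _ => hterm x y) ⟨y, mem_univ y, ?_⟩
      rw [if_neg hne.symm, if_pos hc]
      have hlt' : (G.dist x y : ℝ) < k x + k y := by exact_mod_cast hlt
      refine mul_pos ?_ (by linarith)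
      rcases hc with hc | hc
      · exact mul_pos (hgX x hc.1) (hgX y hc.2)
      · exact mul_pos_of_neg_of_neg (hgY x hc.1) (hgY y hc.2)

theorem IsTwoCentred.steklovLambda₂_le (hG : G.IsTree) (h : IsTwoCentred G X Y k)
    (hleafX : ∀ x ∈ X, IsLeaf G x) (hleafY : ∀ y ∈ Y, IsLeaf G y)
    (hℓ : ∀ v, v ∈ X ∨ v ∈ Y → ℓ v ≤ k v) (hμ : IsSecularRoot X Y ℓ μ) :
    steklovLambda₂ G ≤ μ⁻¹ := by
  obtain ⟨g, hg, hg0, hle, -⟩ := h.exists_charge hleafX hleafY hℓ hμ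
  exact hG.steklovLambda₂_le hg (hμ.pos h.nonempty_left) hle hg0

theorem IsTwoCentred.steklovLambda₂_lt (hG : G.IsTree) (h : IsTwoCentred G X Y k)
    (hleafX : ∀ x ∈ X, IsLeaf G x) (hleafY : ∀ y ∈ Y, IsLeaf G y)
    (hℓ : ∀ v, v ∈ X ∨ v ∈ Y → ℓ v ≤ k v) (hμ : IsSecularRoot X Y ℓ μ)
    (hbr : ∃ x y, x ≠ y ∧ ((x ∈ X ∧ y ∈ X) ∨ (x ∈ Y ∧ y ∈ Y)) ∧ G.dist x y < k x + k y) :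
    steklovLambda₂ G < μ⁻¹ := by
  obtain ⟨g, hg, hg0, -, hlt⟩ := h.exists_charge hleafX hleafY hℓ hμ
  exact hG.steklovLambda₂_lt hg (hμ.pos h.nonempty_left) (hlt hbr) hg0

end Comparison

/-! ### Existence of the secular root and its behaviour under moving arms. -/

section Secular

variable {ι : Type*} {X Y : Finset ι} {ℓ : ι → ℕ} {r : ℕ}

/-- Intermediate values on `[r + 1/2, r + |X|]`. At the left end an arm of length `r` contributes
conductance `2` on each side, so both inverses are at most `1/2`. At the right end each of the `|X|`
arms contributes at most `1/|X|`, so the inverse for `X` is already at least `1`. -/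
theorem exists_isSecularRoot (hX : ∀ x ∈ X, ℓ x ≤ r) (hY : ∀ y ∈ Y, ℓ y ≤ r)
    (hXr : ∃ x ∈ X, ℓ x = r) (hYr : ∃ y ∈ Y, ℓ y = r) :
    ∃ μ : ℝ, (r : ℝ) < μ ∧ IsSecularRoot X Y ℓ μ := by
  obtain ⟨x0, hx0, hx0r⟩ := hXr
  obtain ⟨y0, hy0, hy0r⟩ := hYr
  have hlt : ∀ Z : Finset ι, (∀ z ∈ Z, ℓ z ≤ r) → ∀ μ : ℝ, (r : ℝ) < μ → ∀ z ∈ Z, (ℓ z : ℝ) < μ :=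
    fun Z hZ μ hμ z hz => lt_of_le_of_lt (by exact_mod_cast hZ z hz) hμ
  have hcont : ∀ Z : Finset ι, Z.Nonempty → (∀ z ∈ Z, ℓ z ≤ r) → ∀ b : ℝ,
      ContinuousOn (fun μ => (conductance Z ℓ μ)⁻¹) (Set.Icc ((r : ℝ) + 1 / 2) b) := by
    intro Z hZne hZ b
    refine ContinuousOn.inv₀ ?_ fun μ hμ =>
      (conductance_pos hZne (hlt Z hZ μ (by linarith [hμ.1]))).ne'
    unfold conductance
    refine continuousOn_finsetSum _ fun z hz => ContinuousOn.inv₀ (by fun_prop) fun μ hμ => ?_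
    exact (sub_pos.mpr (hlt Z hZ μ (by linarith [hμ.1]) z hz)).ne'
  have hlow : ∀ Z : Finset ι, (∀ z ∈ Z, ℓ z ≤ r) → (∃ z ∈ Z, ℓ z = r) →
      (conductance Z ℓ ((r : ℝ) + 1 / 2))⁻¹ ≤ 1 / 2 := by
    rintro Z hZ ⟨z, hz, hzr⟩
    have h1 : ((r : ℝ) + 1 / 2 - ℓ z)⁻¹ ≤ conductance Z ℓ ((r : ℝ) + 1 / 2) :=
      single_le_sum (f := fun z => ((r : ℝ) + 1 / 2 - ℓ z)⁻¹)
        (fun z hz => (inv_pos.mpr (sub_pos.mpr (hlt Z hZ _ (by linarith) z hz))).le) hz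
    rw [hzr, add_sub_cancel_left] at h1
    have := inv_anti₀ (by norm_num) h1
    simpa using this
  have hX1 : 1 ≤ X.card := card_pos.mpr ⟨x0, hx0⟩
  have hX1' : (1 : ℝ) ≤ X.card := by exact_mod_cast hX1
  have hhigh : 1 ≤ (conductance X ℓ ((r : ℝ) + X.card))⁻¹ := by
    have h1 : conductance X ℓ ((r : ℝ) + X.card) ≤ 1 := by
      calc conductance X ℓ ((r : ℝ) + X.card) ≤ ∑ x ∈ X, (X.card : ℝ)⁻¹ :=
            sum_le_sum fun x hx => inv_anti₀ (by linarith) (by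
              have : (ℓ x : ℝ) ≤ r := by exact_mod_cast hX x hx
              linarith)
        _ = 1 := by rw [sum_const, nsmul_eq_mul, mul_inv_cancel₀ (by linarith)]
    exact (one_le_inv₀ (conductance_pos ⟨x0, hx0⟩ (hlt X hX _ (by linarith)))).mpr h1
  have hYnn : 0 ≤ (conductance Y ℓ ((r : ℝ) + X.card))⁻¹ :=
    (inv_pos.mpr (conductance_pos ⟨y0, hy0⟩ (hlt Y hY _ (by linarith)))).le
  obtain ⟨μ, hμ, hroot⟩ := intermediate_value_Icc (a := (r : ℝ) + 1 / 2) (b := r + X.card)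
    (by linarith) ((hcont X ⟨x0, hx0⟩ hX _).add (hcont Y ⟨y0, hy0⟩ hY _))
    (show (1 : ℝ) ∈ Set.Icc _ _ from
      ⟨by simpa using (by linarith [hlow X hX ⟨x0, hx0, hx0r⟩, hlow Y hY ⟨y0, hy0, hy0r⟩]),
        by simpa using (by linarith)⟩)
  have hrμ : (r : ℝ) < μ := by linarith [hμ.1]
  exact ⟨μ, hrμ, hlt X hX μ hrμ, hlt Y hY μ hrμ, hroot⟩

theorem conductance_anti {μ μ' : ℝ} (h : ∀ x ∈ X, (ℓ x : ℝ) < μ) (hle : μ ≤ μ') :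
    conductance X ℓ μ' ≤ conductance X ℓ μ :=
  sum_le_sum fun x hx => inv_anti₀ (sub_pos.mpr (h x hx)) (by linarith)

/-- Moving all arms but one from one centre to the other decreases the secular root. -/
theorem IsSecularRoot.lt_of_transfer [DecidableEq ι] {μ μ' : ℝ} (hd : Disjoint X Y) {y0 : ι}
    (hXc : 2 ≤ X.card) (hYc : 2 ≤ Y.card)
    (hx0 : ∃ x ∈ X, ℓ x = ℓ y0) (hy0 : y0 ∈ Y)
    (hμ : IsSecularRoot X Y ℓ μ) (hμ' : IsSecularRoot (X ∪ Y.erase y0) {y0} ℓ μ') : μ' < μ := by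
  obtain ⟨hμX, hμY, hroot⟩ := hμ
  obtain ⟨hμX', hμY', hroot'⟩ := hμ'
  have hXne : X.Nonempty := card_pos.mp (by omega)
  have hdis : Disjoint X (Y.erase y0) := disjoint_of_subset_right (erase_subset _ _) hd
  have hU : ∀ z ∈ X ∪ Y.erase y0, (ℓ z : ℝ) < μ := fun z hz => by
    rcases mem_union.mp hz with hz | hz
    · exact hμX z hz
    · exact hμY z (mem_of_mem_erase hz)
  have hS : ∀ z ∈ ({y0} : Finset ι), (ℓ z : ℝ) < μ := fun z hz => by
    rw [mem_singleton.mp hz]; exact hμY y0 hy0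
  have hm := conductance_pos (singleton_nonempty y0) hS
  set m := conductance {y0} ℓ μ with hmdef
  have hA := conductance_pos hXne hμX
  have hB := conductance_pos ⟨y0, hy0⟩ hμY
  have hsumY : conductance Y ℓ μ = m + conductance (Y.erase y0) ℓ μ := by
    rw [hmdef, conductance, conductance, conductance, sum_singleton]
    exact (add_sum_erase Y (fun y => (μ - ℓ y)⁻¹) hy0).symm
  have hsumU : conductance (X ∪ Y.erase y0) ℓ μ =
      conductance X ℓ μ + conductance (Y.erase y0) ℓ μ := sum_union hdis
  have hYe : 0 < conductance (Y.erase y0) ℓ μ := by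
    refine conductance_pos (card_pos.mp ?_) fun y hy => hμY y (mem_of_mem_erase hy)
    rw [card_erase_of_mem hy0]; omega
  obtain ⟨x0, hx0, hx0r⟩ := hx0
  -- `X` has an arm as long as `y0` and at least one more.
  have hXm : m < conductance X ℓ μ := by
    have h1 : conductance X ℓ μ = m + conductance (X.erase x0) ℓ μ := by
      rw [hmdef, conductance, conductance, conductance, sum_singleton, ← hx0r]
      exact (add_sum_erase X (fun x => (μ - ℓ x)⁻¹) hx0).symm
    have h2 : 0 < conductance (X.erase x0) ℓ μ := by
      refine conductance_pos (card_pos.mp ?_) fun x hx => hμX x (mem_of_mem_erase hx)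
      rw [card_erase_of_mem hx0]; omega
    linarith
  -- Inverse conductances increase with the parameter, so `μ ≤ μ'` would make the transferred
  -- expression at `μ` at most `1`.
  by_contra! hle
  have h1 := conductance_anti hU hle
  have h2 := conductance_anti hS hle
  have hU' := conductance_pos (hXne.mono subset_union_left) hμX'
  have hS' := conductance_pos (singleton_nonempty y0) hμY'
  have h3 := inv_anti₀ hU' h1
  have h4 := inv_anti₀ hS' h2
  rw [hsumU] at h3
  set A := conductance X ℓ μ
  set C := conductance (Y.erase y0) ℓ μ
  rw [hsumY] at hroot
  have h5 : (A + C)⁻¹ + m⁻¹ ≤ A⁻¹ + (m + C)⁻¹ := by linarith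
  -- Both sides have numerator `A + m + C` over a product of conductances; `m (A + C) < A (m + C)`
  -- because `m < A` and `0 < C`.
  have h6 : A⁻¹ + (m + C)⁻¹ < (A + C)⁻¹ + m⁻¹ := by
    have hmC : 0 < m + C := by linarith
    have hAC : 0 < A + C := by linarith
    rw [inv_add_inv hA.ne' hmC.ne', inv_add_inv hAC.ne' hm.ne',
      show A + C + m = A + (m + C) by ring]
    refine div_lt_div_of_pos_left (by linarith) (by positivity) ?_
    nlinarith
  linarith

end Secular
end SimpleGraph

/-! ### Coordinates on spiders. -/

section Spider

variable {n : ℕ} {ℓ : Fin n → ℕ}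

/-- The distance of a vertex of a spider from the centre. -/
def SpiderVertex.height : SpiderVertex ℓ → ℕ
  | none => 0
  | some ⟨_, k⟩ => k + 1

/-- The neighbour of a vertex of a spider on the way to the centre. -/
def SpiderVertex.parent : SpiderVertex ℓ → SpiderVertex ℓ
  | none => none
  | some ⟨i, ⟨0, _⟩⟩ => none
  | some ⟨i, ⟨k + 1, h⟩⟩ => some ⟨i, ⟨k, by omega⟩⟩

/-- The height, counted negatively along the leg `i`. -/
def SpiderVertex.signedHeight (i : Fin n) : SpiderVertex ℓ → ℤ
  | none => 0
  | some ⟨j, k⟩ => if j = i then -((k : ℕ) + 1 : ℤ) else (k : ℕ) + 1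

/-- The end of the leg `i` of a spider. -/
def SpiderVertex.armEnd (hℓ : ∀ i, 1 ≤ ℓ i) (i : Fin n) : SpiderVertex ℓ :=
  some ⟨i, ⟨ℓ i - 1, by have := hℓ i; omega⟩⟩

theorem spider_adj_zero (i : Fin n) (h : 0 < ℓ i) : (spider ℓ).Adj none (some ⟨i, ⟨0, h⟩⟩) := by
  simp [spider, spiderStep]

theorem spider_adj_succ (i : Fin n) (k : ℕ) (h : k + 1 < ℓ i) :
    (spider ℓ).Adj (some ⟨i, ⟨k, by omega⟩⟩) (some ⟨i, ⟨k + 1, h⟩⟩) := by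
  simp [spider, spiderStep]

theorem spider_adj_induction {P : SpiderVertex ℓ → SpiderVertex ℓ → Prop}
    (symm : ∀ v w, P v w → P w v) (zero : ∀ i (h : 0 < ℓ i), P none (some ⟨i, ⟨0, h⟩⟩))
    (succ : ∀ i k (h : k + 1 < ℓ i), P (some ⟨i, ⟨k, by omega⟩⟩) (some ⟨i, ⟨k + 1, h⟩⟩))
    {v w : SpiderVertex ℓ} (h : (spider ℓ).Adj v w) : P v w := by
  have step : ∀ v w, spiderStep ℓ v w → P v w := by
    rintro (_ | ⟨i, k, hk⟩) (_ | ⟨j, m, hm⟩) h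
    · exact h.elim
    · obtain rfl : m = 0 := h
      exact zero _ _
    · exact h.elim
    · obtain ⟨rfl, rfl⟩ : i = j ∧ m = k + 1 := h
      exact succ _ _ _
  rw [spider, SimpleGraph.fromRel_adj] at h
  exact h.2.elim (step _ _) fun h => symm _ _ (step _ _ h)

theorem spider_adj_parent {v : SpiderVertex ℓ} (hv : v ≠ none) :
    (spider ℓ).Adj v v.parent := by
  rcases v with _ | ⟨i, _ | k, h⟩
  · exact absurd rfl hv
  · exact (spider_adj_zero i h).symm
  · exact (spider_adj_succ i k h).symm

theorem SpiderVertex.height_parent {v : SpiderVertex ℓ} (hv : v ≠ none) :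
    v.parent.height + 1 = v.height := by
  rcases v with _ | ⟨i, _ | k, h⟩
  · exact absurd rfl hv
  · rfl
  · rfl

theorem spider_exists_walk (v : SpiderVertex ℓ) :
    ∃ p : (spider ℓ).Walk v none, p.length = v.height := by
  suffices H : ∀ m, ∀ v : SpiderVertex ℓ, v.height = m →
      ∃ p : (spider ℓ).Walk v none, p.length = v.height from H _ v rfl
  intro m
  induction m with
  | zero =>
    rintro (_ | ⟨i, k⟩) h
    · exact ⟨.nil, rfl⟩
    · simp [SpiderVertex.height] at h
  | succ m ih =>
    intro v h
    have hv : v ≠ none := by rintro rfl; simp [SpiderVertex.height] at h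
    have hp := SpiderVertex.height_parent hv
    obtain ⟨p, h1⟩ := ih v.parent (by omega)
    exact ⟨.cons (spider_adj_parent hv) p, by simp [h1, hp]⟩

theorem spider_connected : (spider ℓ).Connected :=
  (SimpleGraph.connected_iff_exists_forall_reachable _).mpr
    ⟨none, fun v => let ⟨p, _⟩ := spider_exists_walk v; p.reachable.symm⟩

theorem SpiderVertex.height_armEnd (hℓ : ∀ i, 1 ≤ ℓ i) (i : Fin n) :
    (armEnd hℓ i).height = ℓ i := by
  have := hℓ i
  simp only [armEnd, height]
  omega

theorem SpiderVertex.armEnd_injective (hℓ : ∀ i, 1 ≤ ℓ i) : Function.Injective (armEnd hℓ) := by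
  intro i j h
  simp only [armEnd, Option.some.injEq, Sigma.mk.injEq] at h
  exact h.1

theorem card_spiderVertex : Fintype.card (SpiderVertex ℓ) = 1 + ∑ i, ℓ i := by
  simp [Fintype.card_option, add_comm]

theorem SpiderVertex.height_le {r : ℕ} (h : ∀ i, ℓ i ≤ r) (v : SpiderVertex ℓ) : v.height ≤ r := by
  rcases v with _ | ⟨i, k, hk⟩
  · exact Nat.zero_le _
  · have := h i
    simp only [height]
    omega

theorem SpiderVertex.signedHeight_armEnd_self (hℓ : ∀ i, 1 ≤ ℓ i) (i : Fin n) :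
    (armEnd hℓ i).signedHeight i = -(ℓ i : ℤ) := by
  have := hℓ i
  simp only [armEnd, signedHeight, if_true]
  omega

theorem SpiderVertex.signedHeight_armEnd_of_ne (hℓ : ∀ i, 1 ≤ ℓ i) {i j : Fin n} (h : j ≠ i) :
    (armEnd hℓ j).signedHeight i = ℓ j := by
  have := hℓ j
  simp only [armEnd, signedHeight, if_neg h]
  omega

theorem SpiderVertex.abs_signedHeight_sub_le (i : Fin n) {v w : SpiderVertex ℓ}
    (h : (spider ℓ).Adj v w) : |v.signedHeight i - w.signedHeight i| ≤ 1 := by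
  refine spider_adj_induction (P := fun v w => |v.signedHeight i - w.signedHeight i| ≤ 1)
    (fun v w h => by rwa [abs_sub_comm]) (fun j _ => ?_) (fun j k _ => ?_) h
  · simp only [signedHeight]
    split_ifs <;> simp
  · simp only [signedHeight]
    split_ifs <;> simp

theorem SpiderVertex.abs_height_sub_le {v w : SpiderVertex ℓ}
    (h : (spider ℓ).Adj v w) : |(v.height : ℤ) - w.height| ≤ 1 := by
  refine spider_adj_induction (P := fun v w : SpiderVertex ℓ => |(v.height : ℤ) - w.height| ≤ 1)
    (fun v w h => by rwa [abs_sub_comm]) (fun j _ => ?_) (fun j k _ => ?_) h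
  · simp [height]
  · simp [height]

end Spider

/-! ### Lipschitz bounds on distance and a parent-map criterion for trees. -/

namespace SimpleGraph

theorem Connected.sub_le_dist {V : Type*} {G : SimpleGraph V} (hG : G.Connected) {φ : V → ℤ}
    (hφ : ∀ v w, G.Adj v w → |φ v - φ w| ≤ 1) (x y : V) : φ y - φ x ≤ G.dist x y := by
  obtain ⟨p, hp⟩ := hG.exists_walk_length_eq_dist x y
  rw [← hp]
  clear hp
  induction p with
  | nil => simp
  | cons h p ih =>
    have := (abs_le.mp (hφ _ _ h)).1
    rw [Walk.length_cons]
    push_cast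
    linarith

/-- Every edge joins a non-root vertex to its parent, so there are at most `|V| - 1` edges;
connectedness supplies the reverse inequality. -/
theorem Connected.isTree_of_parent {V : Type*} [Finite V] {G : SimpleGraph V} (hG : G.Connected)
    (root : V) (π : V → V)
    (hπ : ∀ v w, G.Adj v w → (v ≠ root ∧ w = π v) ∨ (w ≠ root ∧ v = π w)) : G.IsTree := by
  classical
  refine isTree_iff_connected_and_card.mpr ⟨hG, le_antisymm ?_ hG.card_vert_le_card_edgeSet_add_one⟩
  have hsub : G.edgeSet ⊆ (fun v => s(v, π v)) '' {v | v ≠ root} := by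
    intro e
    induction e with
    | h v w =>
      intro h
      rcases hπ v w h with ⟨h1, rfl⟩ | ⟨h1, rfl⟩
      · exact ⟨v, h1, rfl⟩
      · exact ⟨w, h1, Sym2.eq_swap⟩
  have h1 := (Set.ncard_le_ncard hsub (Set.toFinite _)).trans (Set.ncard_image_le (Set.toFinite _))
  have h2 : ({v | v ≠ root} : Set V).ncard + 1 = Nat.card V := by
    have := Set.ncard_add_ncard_compl ({root} : Set V)
    rw [Set.ncard_singleton] at this
    rw [← this, add_comm]
    rfl
  rw [← h2]
  exact Nat.add_le_add_right h1 1

end SimpleGraph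

/-! ### Distances, leaves and `λ₂` of double spiders. -/

section DoubleSpider

open SpiderVertex

variable {p q : ℕ} {a : Fin p → ℕ} {b : Fin q → ℕ}

theorem doubleSpider_adj_inl {v w : SpiderVertex a} :
    (doubleSpider a b).Adj (.inl v) (.inl w) ↔ (spider a).Adj v w := by
  simp [doubleSpider, SimpleGraph.edge_adj]

theorem doubleSpider_adj_inr {v w : SpiderVertex b} :
    (doubleSpider a b).Adj (.inr v) (.inr w) ↔ (spider b).Adj v w := by
  simp [doubleSpider, SimpleGraph.edge_adj]

theorem doubleSpider_adj_inl_inr {v : SpiderVertex a} {w : SpiderVertex b} :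
    (doubleSpider a b).Adj (.inl v) (.inr w) ↔ v = none ∧ w = none := by
  simp [doubleSpider, SimpleGraph.edge_adj]

theorem doubleSpider_adj_centers : (doubleSpider a b).Adj (.inl none) (.inr none) :=
  doubleSpider_adj_inl_inr.mpr ⟨rfl, rfl⟩

theorem doubleSpider_adj_induction
    {P : SpiderVertex a ⊕ SpiderVertex b → SpiderVertex a ⊕ SpiderVertex b → Prop}
    (symm : ∀ v w, P v w → P w v) (left : ∀ v w, (spider a).Adj v w → P (.inl v) (.inl w))
    (right : ∀ v w, (spider b).Adj v w → P (.inr v) (.inr w)) (center : P (.inl none) (.inr none))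
    {v w : SpiderVertex a ⊕ SpiderVertex b} (h : (doubleSpider a b).Adj v w) : P v w := by
  rcases v with v | v <;> rcases w with w | w
  · exact left _ _ (doubleSpider_adj_inl.mp h)
  · obtain ⟨rfl, rfl⟩ := doubleSpider_adj_inl_inr.mp h
    exact center
  · obtain ⟨rfl, rfl⟩ := doubleSpider_adj_inl_inr.mp h.symm
    exact symm _ _ center
  · exact right _ _ (doubleSpider_adj_inr.mp h)

theorem doubleSpider_connected : (doubleSpider a b).Connected :=
  spider_connected.sum_sup_edge spider_connected

theorem spider_adj_eq_parent {n : ℕ} {ℓ : Fin n → ℕ} {v w : SpiderVertex ℓ}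
    (h : (spider ℓ).Adj v w) : (v ≠ none ∧ w = v.parent) ∨ (w ≠ none ∧ v = w.parent) :=
  spider_adj_induction
    (P := fun v w : SpiderVertex ℓ => (v ≠ none ∧ w = v.parent) ∨ (w ≠ none ∧ v = w.parent))
    (fun _ _ h => h.symm) (fun _ _ => .inr ⟨by simp, rfl⟩) (fun _ _ _ => .inr ⟨by simp, rfl⟩) h

theorem doubleSpider_isTree : (doubleSpider a b).IsTree := by
  let π : SpiderVertex a ⊕ SpiderVertex b → SpiderVertex a ⊕ SpiderVertex b :=
    Sum.elim (fun v => .inl (parent v)) fun v => if v = none then .inl none else .inr (parent v)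
  refine doubleSpider_connected.isTree_of_parent (.inl none) π fun v w h => ?_
  refine doubleSpider_adj_induction
    (P := fun v w => (v ≠ Sum.inl none ∧ w = π v) ∨ (w ≠ Sum.inl none ∧ v = π w))
    (fun _ _ h => h.symm) (fun v w h => ?_) (fun v w h => ?_) (by simp [π]) h
  · simpa [π] using spider_adj_eq_parent h
  · rcases spider_adj_eq_parent h with ⟨h1, h2⟩ | ⟨h1, h2⟩
    · exact .inl ⟨by simp, by simp [π, h1, h2]⟩
    · exact .inr ⟨by simp, by simp [π, h1, h2]⟩

theorem doubleSpider_dist_inl_le (v : SpiderVertex a) :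
    (doubleSpider a b).dist (.inl v) (.inl none) ≤ v.height := by
  obtain ⟨w, hw⟩ := spider_exists_walk v
  have := SimpleGraph.dist_le (w.map (⟨Sum.inl, doubleSpider_adj_inl.mpr⟩ :
    spider a →g doubleSpider a b))
  rw [SimpleGraph.Walk.length_map, hw] at this
  exact this

theorem doubleSpider_dist_inr_le (v : SpiderVertex b) :
    (doubleSpider a b).dist (.inr v) (.inr none) ≤ v.height := by
  obtain ⟨w, hw⟩ := spider_exists_walk v
  have := SimpleGraph.dist_le (w.map (⟨Sum.inr, doubleSpider_adj_inr.mpr⟩ :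
    spider b →g doubleSpider a b))
  rw [SimpleGraph.Walk.length_map, hw] at this
  exact this

theorem doubleSpider_dist_inl_inl_le (v w : SpiderVertex a) :
    (doubleSpider a b).dist (.inl v) (.inl w) ≤ v.height + w.height := by
  have h := doubleSpider_connected.dist_triangle (G := doubleSpider a b)
    (u := .inl v) (v := .inl none) (w := .inl w)
  rw [(doubleSpider a b).dist_comm (u := .inl none)] at h
  exact h.trans (add_le_add (doubleSpider_dist_inl_le v) (doubleSpider_dist_inl_le w))

theorem doubleSpider_dist_inr_inr_le (v w : SpiderVertex b) :
    (doubleSpider a b).dist (.inr v) (.inr w) ≤ v.height + w.height := by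
  have h := doubleSpider_connected.dist_triangle (G := doubleSpider a b)
    (u := .inr v) (v := .inr none) (w := .inr w)
  rw [(doubleSpider a b).dist_comm (u := .inr none)] at h
  exact h.trans (add_le_add (doubleSpider_dist_inr_le v) (doubleSpider_dist_inr_le w))

theorem doubleSpider_dist_inl_inr_le (v : SpiderVertex a) (w : SpiderVertex b) :
    (doubleSpider a b).dist (.inl v) (.inr w) ≤ v.height + 1 + w.height := by
  have h := doubleSpider_connected.dist_triangle (G := doubleSpider a b)
    (u := .inl v) (v := .inl none) (w := .inr w)
  have h' := doubleSpider_connected.dist_triangle (G := doubleSpider a b)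
    (u := .inl none) (v := .inr none) (w := .inr w)
  rw [SimpleGraph.dist_eq_one_iff_adj.mpr doubleSpider_adj_centers,
    (doubleSpider a b).dist_comm (u := .inr none)] at h'
  have := doubleSpider_dist_inl_le (b := b) v
  have := doubleSpider_dist_inr_le (a := a) w
  omega

/-- A 1-Lipschitz function that descends along arm `i` and ascends along all others, shifted by one
across the central edge. It gives the exact distance from the end of arm `i` to every other arm end.
-/
theorem doubleSpider_signedHeight_left (i : Fin p) (x y : SpiderVertex a ⊕ SpiderVertex b) :
    (Sum.elim (fun v => v.signedHeight i) (fun v => (v.height : ℤ) + 1) y) -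
      (Sum.elim (fun v => v.signedHeight i) (fun v => (v.height : ℤ) + 1) x) ≤
      (doubleSpider a b).dist x y := by
  refine doubleSpider_connected.sub_le_dist (fun v w h => ?_) x y
  refine doubleSpider_adj_induction (P := fun v w : SpiderVertex a ⊕ SpiderVertex b =>
    |(Sum.elim (fun v => v.signedHeight i) (fun v => (v.height : ℤ) + 1) v) -
      (Sum.elim (fun v => v.signedHeight i) (fun v => (v.height : ℤ) + 1) w)| ≤ 1)
    (fun v w h => by rwa [abs_sub_comm]) (fun v w h => ?_) (fun v w h => ?_) ?_ h
  · exact abs_signedHeight_sub_le i h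
  · simpa using abs_height_sub_le h
  · simp [signedHeight, height]

theorem doubleSpider_signedHeight_right (j : Fin q) (x y : SpiderVertex a ⊕ SpiderVertex b) :
    (Sum.elim (fun v => (v.height : ℤ) + 1) (fun v => v.signedHeight j) y) -
      (Sum.elim (fun v => (v.height : ℤ) + 1) (fun v => v.signedHeight j) x) ≤
      (doubleSpider a b).dist x y := by
  refine doubleSpider_connected.sub_le_dist (fun v w h => ?_) x y
  refine doubleSpider_adj_induction (P := fun v w : SpiderVertex a ⊕ SpiderVertex b =>
    |(Sum.elim (fun v => (v.height : ℤ) + 1) (fun v => v.signedHeight j) v) -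
      (Sum.elim (fun v => (v.height : ℤ) + 1) (fun v => v.signedHeight j) w)| ≤ 1)
    (fun v w h => by rwa [abs_sub_comm]) (fun v w h => ?_) (fun v w h => ?_) ?_ h
  · simpa using abs_height_sub_le h
  · exact abs_signedHeight_sub_le j h
  · simp [signedHeight, height]

theorem doubleSpider_dist_armEnd_left (ha : ∀ i, 1 ≤ a i) {i i' : Fin p} (h : i ≠ i') :
    (doubleSpider a b).dist (.inl (armEnd ha i)) (.inl (armEnd ha i')) = a i + a i' := by
  refine le_antisymm ?_ ?_
  · have := doubleSpider_dist_inl_inl_le (b := b) (armEnd ha i) (armEnd ha i')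
    rwa [height_armEnd, height_armEnd] at this
  · have := doubleSpider_signedHeight_left (b := b) i (.inl (armEnd ha i)) (.inl (armEnd ha i'))
    simp only [Sum.elim_inl, signedHeight_armEnd_self, signedHeight_armEnd_of_ne ha h.symm] at this
    omega

theorem doubleSpider_dist_armEnd_right (hb : ∀ j, 1 ≤ b j) {j j' : Fin q} (h : j ≠ j') :
    (doubleSpider a b).dist (.inr (armEnd hb j)) (.inr (armEnd hb j')) = b j + b j' := by
  refine le_antisymm ?_ ?_
  · have := doubleSpider_dist_inr_inr_le (a := a) (armEnd hb j) (armEnd hb j')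
    rwa [height_armEnd, height_armEnd] at this
  · have := doubleSpider_signedHeight_right (a := a) j (.inr (armEnd hb j)) (.inr (armEnd hb j'))
    simp only [Sum.elim_inr, signedHeight_armEnd_self, signedHeight_armEnd_of_ne hb h.symm] at this
    omega

theorem doubleSpider_dist_armEnd_cross (ha : ∀ i, 1 ≤ a i) (hb : ∀ j, 1 ≤ b j) (i : Fin p) (j : Fin q) :
    (doubleSpider a b).dist (.inl (armEnd ha i)) (.inr (armEnd hb j)) = a i + 1 + b j := by
  refine le_antisymm ?_ ?_
  · have := doubleSpider_dist_inl_inr_le (armEnd ha i) (armEnd hb j)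
    rwa [height_armEnd, height_armEnd] at this
  · have := doubleSpider_signedHeight_left i (.inl (armEnd ha i)) (.inr (armEnd hb j))
    simp only [Sum.elim_inl, Sum.elim_inr, signedHeight_armEnd_self, height_armEnd] at this
    omega

theorem doubleSpider_diam (ha : ∀ i, 1 ≤ a i) (hb : ∀ j, 1 ≤ b j) {r : ℕ}
    (har : ∀ i, a i ≤ r) (hbr : ∀ j, b j ≤ r) {i : Fin p} {j : Fin q}
    (hi : a i = r) (hj : b j = r) : (doubleSpider a b).diam = 2 * r + 1 := by
  have : Nonempty (SpiderVertex a ⊕ SpiderVertex b) := ⟨.inl none⟩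
  apply le_antisymm
  · obtain ⟨x, y, h⟩ := (doubleSpider a b).exists_dist_eq_diam
    rw [← h]
    rcases x with x | x <;> rcases y with y | y
    · have := doubleSpider_dist_inl_inl_le (b := b) x y
      have := height_le har x
      have := height_le har y
      omega
    · have := doubleSpider_dist_inl_inr_le x y
      have := height_le har x
      have := height_le hbr y
      omega
    · have := doubleSpider_dist_inl_inr_le y x
      have := height_le hbr x
      have := height_le har y
      rw [SimpleGraph.dist_comm]
      omega
    · have := doubleSpider_dist_inr_inr_le (a := a) x y
      have := height_le hbr x
      have := height_le hbr y
      omega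
  · have h := SimpleGraph.dist_le_diam (SimpleGraph.connected_iff_ediam_ne_top.mp
      (doubleSpider_connected (a := a) (b := b)))
      (u := .inl (armEnd ha i)) (v := .inr (armEnd hb j))
    rw [doubleSpider_dist_armEnd_cross, hi, hj] at h
    omega

theorem spider_eq_armEnd_or {n : ℕ} {ℓ : Fin n → ℕ} (hℓ : ∀ i, 1 ≤ ℓ i) (v : SpiderVertex ℓ) :
    v = none ∨ (∃ i, v = armEnd hℓ i) ∨
      ∃ x y, x ≠ y ∧ (spider ℓ).Adj v x ∧ (spider ℓ).Adj v y := by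
  rcases v with _ | ⟨i, k, hk⟩
  · exact .inl rfl
  · right
    by_cases h : k + 1 = ℓ i
    · left
      refine ⟨i, ?_⟩
      simp only [armEnd, Option.some.injEq, Sigma.mk.injEq, heq_eq_eq, Fin.mk.injEq, true_and]
      omega
    · right
      have hk' : k + 1 < ℓ i := by omega
      refine ⟨_, _, ?_, spider_adj_succ i k hk', spider_adj_parent (by simp)⟩
      intro he
      have h1 := congrArg SpiderVertex.height he
      have h2 := SpiderVertex.height_parent (v := (some ⟨i, ⟨k, hk⟩⟩ : SpiderVertex ℓ)) (by simp)
      simp only [SpiderVertex.height] at h1 h2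
      omega

theorem doubleSpider_armEnd_of_isLeaf (ha : ∀ i, 1 ≤ a i) (hb : ∀ j, 1 ≤ b j) (i0 : Fin p) (j0 : Fin q)
    {v : SpiderVertex a ⊕ SpiderVertex b} (hv : IsLeaf (doubleSpider a b) v) :
    (∃ i, v = .inl (armEnd ha i)) ∨ ∃ j, v = .inr (armEnd hb j) := by
  rcases v with v | v
  · rcases spider_eq_armEnd_or ha v with rfl | ⟨i, rfl⟩ | ⟨x, y, hne, hx, hy⟩
    · exact absurd hv (SimpleGraph.not_isLeaf_of_adj_of_adj doubleSpider_adj_centers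
        (doubleSpider_adj_inl.mpr (spider_adj_zero i0 (ha i0))) (by simp))
    · exact .inl ⟨i, rfl⟩
    · exact absurd hv (SimpleGraph.not_isLeaf_of_adj_of_adj (doubleSpider_adj_inl.mpr hx)
        (doubleSpider_adj_inl.mpr hy) (by simpa using hne))
  · rcases spider_eq_armEnd_or hb v with rfl | ⟨j, rfl⟩ | ⟨x, y, hne, hx, hy⟩
    · exact absurd hv (SimpleGraph.not_isLeaf_of_adj_of_adj doubleSpider_adj_centers.symm
        (doubleSpider_adj_inr.mpr (spider_adj_zero j0 (hb j0))) (by simp))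
    · exact .inr ⟨j, rfl⟩
    · exact absurd hv (SimpleGraph.not_isLeaf_of_adj_of_adj (doubleSpider_adj_inr.mpr hx)
        (doubleSpider_adj_inr.mpr hy) (by simpa using hne))

open SimpleGraph in
theorem doubleSpider_inv_le_steklovLambda₂ (ha : ∀ i, 1 ≤ a i) (hb : ∀ j, 1 ≤ b j) [NeZero p] [NeZero q] {μ : ℝ}
    (hμa : ∀ i, (a i : ℝ) < μ) (hμb : ∀ j, (b j : ℝ) < μ)
    (hμ : (conductance univ a μ)⁻¹ + (conductance univ b μ)⁻¹ = 1) :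
    μ⁻¹ ≤ steklovLambda₂ (doubleSpider a b) := by
  classical
  set X : Finset (SpiderVertex a ⊕ SpiderVertex b) := univ.image fun i => .inl (armEnd ha i)
    with hX
  set Y : Finset (SpiderVertex a ⊕ SpiderVertex b) := univ.image fun j => .inr (armEnd hb j)
    with hY
  set k : SpiderVertex a ⊕ SpiderVertex b → ℕ := Sum.elim height height with hk
  have hka : ∀ i, k (.inl (armEnd ha i)) = a i := fun i => height_armEnd ha i
  have hkb : ∀ j, k (.inr (armEnd hb j)) = b j := fun j => height_armEnd hb j
  have hXmem : ∀ x ∈ X, ∃ i, x = .inl (armEnd ha i) := fun x hx => by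
    obtain ⟨i, -, rfl⟩ := mem_image.mp hx
    exact ⟨i, rfl⟩
  have hYmem : ∀ y ∈ Y, ∃ j, y = .inr (armEnd hb j) := fun y hy => by
    obtain ⟨j, -, rfl⟩ := mem_image.mp hy
    exact ⟨j, rfl⟩
  have hcX : conductance X k μ = conductance univ a μ := by
    rw [conductance, hX, sum_image fun i _ i' _ h => armEnd_injective ha (Sum.inl_injective h)]
    simp only [hka, conductance]
  have hcY : conductance Y k μ = conductance univ b μ := by
    rw [conductance, hY, sum_image fun i _ i' _ h => armEnd_injective hb (Sum.inr_injective h)]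
    simp only [hkb, conductance]
  have hdX : ∀ x ∈ X, ∀ x' ∈ X, x ≠ x' → (doubleSpider a b).dist x x' = k x + k x' := by
    intro x hx x' hx' hne
    obtain ⟨i, rfl⟩ := hXmem x hx
    obtain ⟨i', rfl⟩ := hXmem x' hx'
    rw [hka, hka, doubleSpider_dist_armEnd_left ha (by rintro rfl; exact hne rfl)]
  have hdY : ∀ y ∈ Y, ∀ y' ∈ Y, y ≠ y' → (doubleSpider a b).dist y y' = k y + k y' := by
    intro y hy y' hy' hne
    obtain ⟨j, rfl⟩ := hYmem y hy
    obtain ⟨j', rfl⟩ := hYmem y' hy'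
    rw [hkb, hkb, doubleSpider_dist_armEnd_right hb (by rintro rfl; exact hne rfl)]
  have hle : ∀ Z : Finset (SpiderVertex a ⊕ SpiderVertex b),
      (∀ x ∈ Z, ∀ x' ∈ Z, x ≠ x' → (doubleSpider a b).dist x x' = k x + k x') →
      ∀ x ∈ Z, ∀ x' ∈ Z, (doubleSpider a b).dist x x' ≤ k x + k x' := by
    intro Z hZ x hx x' hx'
    by_cases h : x = x'
    · rw [h, dist_self]; exact Nat.zero_le _
    · exact (hZ x hx x' hx' h).le
  have htwo : IsTwoCentred (doubleSpider a b) X Y k := by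
    refine ⟨?_, univ_nonempty.image _, univ_nonempty.image _, hle X hdX, hle Y hdY, ?_⟩
    · rw [Finset.disjoint_left]
      intro x hx hy
      obtain ⟨i, rfl⟩ := hXmem x hx
      obtain ⟨j, h⟩ := hYmem _ hy
      simp at h
    · intro x hx y hy
      obtain ⟨i, rfl⟩ := hXmem x hx
      obtain ⟨j, rfl⟩ := hYmem y hy
      rw [hka, hkb, doubleSpider_dist_armEnd_cross]
  refine htwo.inv_le_steklovLambda₂ doubleSpider_isTree ?_ hdX hdY ⟨?_, ?_, by rw [hcX, hcY, hμ]⟩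
  · intro v hv
    rcases doubleSpider_armEnd_of_isLeaf ha hb 0 0 hv with ⟨i, rfl⟩ | ⟨j, rfl⟩
    · exact .inl (mem_image_of_mem _ (mem_univ i))
    · exact .inr (mem_image_of_mem _ (mem_univ j))
  · intro x hx
    obtain ⟨i, rfl⟩ := hXmem x hx
    rw [hka]; exact hμa i
  · intro y hy
    obtain ⟨j, rfl⟩ := hYmem y hy
    rw [hkb]; exact hμb j

theorem exists_antitone_enumeration {ι : Type*} {X : Finset ι} (hX : X.Nonempty) (ℓ : ι → ℕ) :
    ∃ (p : ℕ) (e : Fin (p + 1) ≃ X), Antitone fun i => ℓ (e i) := by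
  obtain ⟨p, hp⟩ := Nat.exists_eq_succ_of_ne_zero (card_ne_zero.mpr hX)
  let e : Fin (p + 1) ≃ X := (X.equivFinOfCardEq hp).symm
  let f : Fin (p + 1) → ℕᵒᵈ := fun i => OrderDual.toDual (ℓ (e i))
  exact ⟨p, (Tuple.sort f).trans e, fun i j h => Tuple.monotone_sort f h⟩

/-- Prescribed arm lengths are realized by a double spider with sorted arms. -/
theorem exists_doubleSpider {ι : Type*} {X Y : Finset ι} {ℓ : ι → ℕ} {r : ℕ}
    (hX : ∀ x ∈ X, 1 ≤ ℓ x ∧ ℓ x ≤ r) (hY : ∀ y ∈ Y, 1 ≤ ℓ y ∧ ℓ y ≤ r)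
    (hXr : ∃ x ∈ X, ℓ x = r) (hYr : ∃ y ∈ Y, ℓ y = r) :
    ∃ (p q : ℕ) (a : Fin (p + 1) → ℕ) (b : Fin (q + 1) → ℕ),
      IsArmProfile a ∧ IsArmProfile b ∧ a 0 = r ∧ b 0 = r ∧ (∀ i, a i ≤ r) ∧ (∀ j, b j ≤ r) ∧
      Fintype.card (SpiderVertex a ⊕ SpiderVertex b) =
        (1 + ∑ x ∈ X, ℓ x) + (1 + ∑ y ∈ Y, ℓ y) ∧
      (doubleSpider a b).diam = 2 * r + 1 ∧
      ∀ μ : ℝ, SimpleGraph.IsSecularRoot X Y ℓ μ → μ⁻¹ ≤ steklovLambda₂ (doubleSpider a b) := by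
  have key : ∀ Z : Finset ι, (∀ x ∈ Z, 1 ≤ ℓ x ∧ ℓ x ≤ r) → (∃ x ∈ Z, ℓ x = r) →
      ∃ (p : ℕ) (a : Fin (p + 1) → ℕ), IsArmProfile a ∧ a 0 = r ∧ (∀ i, a i ≤ r) ∧
        ∑ i, a i = ∑ x ∈ Z, ℓ x ∧ ∀ μ : ℝ, (∀ x ∈ Z, (ℓ x : ℝ) < μ) →
          (∀ i, (a i : ℝ) < μ) ∧
            SimpleGraph.conductance univ a μ = SimpleGraph.conductance Z ℓ μ := by
    rintro Z hZ ⟨x0, hx0, hr⟩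
    obtain ⟨p, e, he⟩ := exists_antitone_enumeration ⟨x0, hx0⟩ ℓ
    -- Polymorphic because it reindexes both the natural-number lengths and the real conductances.
    have hsum : ∀ {M : Type} [AddCommMonoid M] (f : ι → M),
        ∑ i, f (e i) = ∑ x ∈ Z, f x := fun f => by
      rw [e.sum_comp fun x : Z => f x, sum_coe_sort Z f]
    refine ⟨p, fun i => ℓ (e i), ⟨he, fun i => (hZ _ (e i).2).1⟩, ?_, fun i => (hZ _ (e i).2).2,
      hsum ℓ, fun μ hμ => ⟨fun i => hμ _ (e i).2, ?_⟩⟩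
    · refine le_antisymm (hZ _ (e 0).2).2 ?_
      have h1 := he (Fin.zero_le (e.symm ⟨x0, hx0⟩))
      simp only [Equiv.apply_symm_apply, hr] at h1
      exact h1
    · exact hsum fun x => (μ - ℓ x)⁻¹
  obtain ⟨p, a, ha, ha0, har, has, haμ⟩ := key X hX hXr
  obtain ⟨q, b, hb, hb0, hbr, hbs, hbμ⟩ := key Y hY hYr
  refine ⟨p, q, a, b, ha, hb, ha0, hb0, har, hbr, ?_, doubleSpider_diam ha.2 hb.2 har hbr ha0 hb0,
    fun μ hμ => ?_⟩
  · rw [Fintype.card_sum, card_spiderVertex, card_spiderVertex, has, hbs]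
  · obtain ⟨h1, h2⟩ := haμ μ hμ.1
    obtain ⟨h3, h4⟩ := hbμ μ hμ.2.1
    exact doubleSpider_inv_le_steklovLambda₂ ha.2 hb.2 h1 h3 (by rw [h2, h4]; exact hμ.2.2)

end DoubleSpider

/-! ### Invariance under isomorphism. -/

section Transport

variable {V W : Type*} {G : SimpleGraph V} {H : SimpleGraph W}

theorem SimpleGraph.Iso.isLeaf_iff (e : G ≃g H) (v : V) : IsLeaf H (e v) ↔ IsLeaf G v := by
  constructor
  · rintro ⟨w, hw, huniq⟩
    refine ⟨e.symm w, e.map_adj_iff.mp (by simpa using hw), fun y hy => ?_⟩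
    rw [← huniq (e y) (e.map_adj_iff.mpr hy)]
    simp
  · rintro ⟨w, hw, huniq⟩
    refine ⟨e w, e.map_adj_iff.mpr hw, fun y hy => ?_⟩
    rw [← huniq (e.symm y) (e.map_adj_iff.mp (by simpa using hy))]
    simp

theorem SimpleGraph.Iso.graphLaplacian_comp [Fintype V] [Fintype W] (e : G ≃g H) (f : W → ℝ)
    (v : V) : graphLaplacian G (f ∘ e) v = graphLaplacian H f (e v) := by
  classical
  simp only [graphLaplacian, sum_filter, Function.comp_apply]
  refine Fintype.sum_equiv e.toEquiv _ _ fun w => ?_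
  have : H.Adj (e v) (e w) ↔ G.Adj v w := e.map_adj_iff
  simp [this]

theorem SimpleGraph.Iso.isSteklovEigenvalue [Fintype V] [Fintype W] (e : G ≃g H) {μ : ℝ}
    (h : IsSteklovEigenvalue H μ) : IsSteklovEigenvalue G μ := by
  obtain ⟨h0, f, hf, hint, hbd⟩ := h
  refine ⟨h0, f ∘ e, fun hz => hf ?_, fun v hv => ?_, fun ω ω' hl ha => ?_⟩
  · ext w
    simpa using congrFun hz (e.symm w)
  · rw [e.graphLaplacian_comp]
    exact hint _ fun hl => hv ((e.isLeaf_iff v).mp hl)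
  · exact hbd _ _ ((e.isLeaf_iff ω).mpr hl) (e.map_adj_iff.mpr ha)

theorem SimpleGraph.Iso.steklovLambda₂_eq [Fintype V] [Fintype W] (e : G ≃g H) :
    steklovLambda₂ G = steklovLambda₂ H := by
  unfold steklovLambda₂
  congr 1
  ext μ
  exact and_congr_right fun _ => ⟨e.symm.isSteklovEigenvalue, e.isSteklovEigenvalue⟩

theorem SimpleGraph.Iso.diam_le [Finite W] (e : G ≃g H) (hG : G.Connected) (hH : H.Connected) :
    G.diam ≤ H.diam := by
  have := hG.nonempty
  have := hH.nonempty
  obtain ⟨x, y, h⟩ := G.exists_dist_eq_diam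
  obtain ⟨p, hp⟩ := hH.exists_walk_length_eq_dist (e x) (e y)
  have h1 := dist_le (p.map e.symm.toHom)
  rw [Walk.length_map, hp] at h1
  have h2 : G.dist x y ≤ H.dist (e x) (e y) := by simpa using h1
  rw [← h]
  exact h2.trans (dist_le_diam (connected_iff_ediam_ne_top.mp hH))

theorem SimpleGraph.Iso.diam_eq [Finite V] [Finite W] (e : G ≃g H) (hG : G.Connected)
    (hH : H.Connected) : G.diam = H.diam :=
  le_antisymm (e.diam_le hG hH) (e.symm.diam_le hH hG)

/-- A tree is a minimal connected graph, so a connected spanning subgraph of it is the whole tree;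
adjacency need only be checked in one direction. -/
theorem SimpleGraph.IsTree.nonempty_iso_of_bijective (hG : G.IsTree) (hH : H.Connected)
    {φ : W → V} (hφ : Function.Bijective φ) (hadj : ∀ v w, H.Adj v w → G.Adj (φ v) (φ w)) :
    Nonempty (G ≃g H) := by
  let e := Equiv.ofBijective φ hφ
  let i : G.comap e ≃g G := SimpleGraph.Iso.comap e G
  have hmin := isTree_iff_minimal_connected.mp (i.isTree_iff.mpr hG)
  have hle : H ≤ G.comap e := fun v w h => hadj v w h
  have heq : H = G.comap e := le_antisymm hle (hmin.2 hH hle)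
  rw [heq]
  exact ⟨i.symm⟩

end Transport

theorem exists_sum_eq_of_le {ι : Type*} (S : Finset ι) (k : ι → ℕ) {N : ℕ} (hk : ∀ x ∈ S, 1 ≤ k x)
    (h1 : S.card ≤ N) (h2 : N ≤ ∑ x ∈ S, k x) :
    ∃ ℓ : ι → ℕ, (∀ x ∈ S, 1 ≤ ℓ x ∧ ℓ x ≤ k x) ∧ ∑ x ∈ S, ℓ x = N := by
  classical
  induction S using Finset.induction_on generalizing N with
  | empty => exact ⟨0, by simp, by simpa [eq_comm] using h2⟩
  | insert s S hs ih =>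
    rw [card_insert_of_notMem hs] at h1
    rw [sum_insert hs] at h2
    have hks := hk s (mem_insert_self _ _)
    have hcard : S.card ≤ ∑ x ∈ S, k x := by
      rw [card_eq_sum_ones]
      exact sum_le_sum fun x hx => hk x (mem_insert_of_mem hx)
    -- Greedy choice: `s` receives one unit, or whatever the remaining elements cannot absorb.
    set t := max 1 (N - ∑ x ∈ S, k x) with ht
    obtain ⟨ℓ, hℓ, hsum⟩ := ih (N := N - t) (fun x hx => hk x (mem_insert_of_mem hx)) (by omega)
      (by omega)
    refine ⟨Function.update ℓ s t, fun x hx => ?_, ?_⟩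
    · rcases mem_insert.mp hx with rfl | hxS
      · rw [Function.update_self]; omega
      · rw [Function.update_of_ne (by rintro rfl; exact hs hxS)]
        exact hℓ x hxS
    · have hcongr : ∑ x ∈ S, Function.update ℓ s t x = ∑ x ∈ S, ℓ x :=
        sum_congr rfl fun x hx => Function.update_of_ne (by rintro rfl; exact hs hx) _ _
      rw [sum_insert hs, Function.update_self, hcongr, hsum]
      omega

/-! ### Reading spiders and arm lengths off the leaves of a tree. -/

namespace SimpleGraph

variable {V : Type*} {G : SimpleGraph V}

/-- Leg `i` is laid along the geodesic from `u` to `x i`. The distance hypothesis forces these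
geodesics to meet only at `u`, which gives injectivity. -/
theorem IsTree.exists_spider_map (hG : G.IsTree) {u : V} {n : ℕ} {x : Fin n → V} {ℓ : Fin n → ℕ}
    (hℓ : ∀ i, ℓ i = G.dist u (x i))
    (hx : ∀ i j, i ≠ j → G.dist u (x i) + G.dist u (x j) ≤ G.dist (x i) (x j)) :
    ∃ φ : SpiderVertex ℓ → V, φ none = u ∧ Function.Injective φ ∧
      (∀ v w, (spider ℓ).Adj v w → G.Adj (φ v) (φ w)) ∧
      (∀ w, w ∈ Set.range φ ↔ w = u ∨ ∃ i, G.dist u w + G.dist w (x i) = G.dist u (x i)) := by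
  have hex : ∀ i : Fin n, ∀ k : Fin (ℓ i), ∃ w, G.dist u w = k + 1 ∧
      (k : ℕ) + 1 + G.dist w (x i) = G.dist u (x i) := fun i k =>
    hG.connected.exists_between (by rw [← hℓ i]; exact k.2)
  choose f hf1 hf2 using hex
  refine ⟨fun | none => u | some ⟨i, k⟩ => f i k, rfl, ?_, ?_, ?_⟩
  · rintro (_ | ⟨i, k⟩) (_ | ⟨j, m⟩) h
    · rfl
    · have := hf1 j m
      simp only at h
      rw [← h, dist_self] at this
      omega
    · have := hf1 i k
      simp only at h
      rw [h, dist_self] at this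
      omega
    · simp only at h
      have h1 := hf1 i k
      have h2 := hf2 i k
      have h3 := hf1 j m
      have h4 := hf2 j m
      rw [h] at h1 h2
      by_cases hij : i = j
      · subst hij
        have : k = m := Fin.ext (by omega)
        rw [this]
      · have h5 := hx i j hij
        have h6 := hG.connected.dist_triangle (u := x i) (v := f j m) (w := x j)
        rw [G.dist_comm (u := x i) (v := f j m)] at h6
        omega
  · intro v w h
    refine spider_adj_induction (P := fun v w : SpiderVertex ℓ =>
      G.Adj ((fun | none => u | some ⟨i, k⟩ => f i k : SpiderVertex ℓ → V) v)
        ((fun | none => u | some ⟨i, k⟩ => f i k : SpiderVertex ℓ → V) w))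
      (fun _ _ h => h.symm) (fun i h => ?_) (fun i k h => ?_) h
    · exact dist_eq_one_iff_adj.mp (hf1 i ⟨0, h⟩)
    · have h1 := hf1 i ⟨k, by omega⟩
      have h2 := hf2 i ⟨k, by omega⟩
      have h3 := hf1 i ⟨k + 1, h⟩
      have h4 := hf2 i ⟨k + 1, h⟩
      simp only at h1 h2 h3 h4 ⊢
      have hne : f i ⟨k + 1, h⟩ ≠ u := by
        intro h5
        rw [h5, dist_self] at h3
        omega
      obtain ⟨z, hz, hzd⟩ := hG.connected.exists_adj_dist_succ hne
      have h5 := hG.connected.dist_triangle (u := u) (v := z) (w := x i)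
      have h6 := hG.connected.dist_le_succ_of_adj (x i) hz
      rw [G.dist_comm (u := x i), G.dist_comm (u := x i)] at h6
      have : f i ⟨k, by omega⟩ = z :=
        hG.eq_of_between (u := u) (x := x i) (by omega) (by omega) (by omega)
      rw [this]
      exact hz.symm
  · intro w
    constructor
    · rintro ⟨_ | ⟨i, k⟩, rfl⟩
      · exact .inl rfl
      · exact .inr ⟨i, by simp only [hf1]; exact hf2 i k⟩
    · rintro (rfl | ⟨i, hi⟩)
      · exact ⟨none, rfl⟩
      · by_cases hw : w = u
        · exact ⟨none, hw.symm⟩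
        have hpos := hG.connected.pos_dist_of_ne (Ne.symm hw)
        refine ⟨some ⟨i, ⟨G.dist u w - 1, by rw [hℓ i]; omega⟩⟩, ?_⟩
        have h1 := hf1 i ⟨G.dist u w - 1, by rw [hℓ i]; omega⟩
        have h2 := hf2 i ⟨G.dist u w - 1, by rw [hℓ i]; omega⟩
        simp only at h1 h2 ⊢
        exact hG.eq_of_between (u := u) (x := x i) (by omega) (by omega) hi

theorem IsTree.isSpider_of_dist [Finite V] (hG : G.IsTree) {u : V} (hu : ¬ IsLeaf G u)
    (h : ∀ x y, IsLeaf G x → IsLeaf G y → x ≠ y → G.dist u x + G.dist u y ≤ G.dist x y) :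
    IsSpider G := by
  obtain ⟨n, ⟨e⟩⟩ := Finite.exists_equiv_fin {x // IsLeaf G x}
  obtain ⟨φ, h0, hinj, hadj, hrange⟩ := hG.exists_spider_map (u := u)
    (x := fun i => ((e.symm i : {x // IsLeaf G x}) : V))
    (ℓ := fun i => G.dist u (e.symm i : {x // IsLeaf G x})) (fun i => rfl)
    (fun i j hij => h _ _ (e.symm i).2 (e.symm j).2
      fun heq => hij (e.symm.injective (Subtype.ext heq)))
  refine ⟨n, _, fun i => ?_, hG.nonempty_iso_of_bijective spider_connected ⟨hinj, fun w => ?_⟩ hadj⟩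
  · exact hG.connected.pos_dist_of_ne fun heq => hu (heq ▸ (e.symm i).2)
  · refine (hrange w).mpr ?_
    by_cases hw : w = u
    · exact .inl hw
    · obtain ⟨x, hx, hb⟩ := hG.exists_isLeaf_between hw
      exact .inr ⟨e ⟨x, hx⟩, by simpa using hb⟩

theorem IsTree.dist_lt_of_between (hG : G.IsTree) {u v x w : V} (huv : G.Adj u v)
    (hx : G.dist x u < G.dist x v) (hb : G.dist u w + G.dist w x = G.dist u x) :
    G.dist w u < G.dist w v := by
  refine (hG.dist_lt_or_lt huv w).resolve_right fun hw => ?_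
  have h1 := hG.dist_of_opposite huv hx hw
  rw [G.dist_comm (u := w) (v := x)] at hb
  rw [G.dist_comm (u := u) (v := x)] at hb
  omega

theorem IsTree.dist_lt_of_between_of_ne (hG : G.IsTree) {u v x w : V} (huv : G.Adj u v)
    (hw : G.dist w u < G.dist w v) (hne : w ≠ u)
    (hb : G.dist u w + G.dist w x = G.dist u x) : G.dist x u < G.dist x v := by
  refine (hG.dist_lt_or_lt huv x).resolve_right fun hx => ?_
  have h1 := hG.dist_of_opposite huv hw hx
  have h2 := hG.connected.pos_dist_of_ne hne
  have h3 := hG.connected.dist_le_succ_of_adj x huv.symm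
  rw [G.dist_comm (u := x), G.dist_comm (u := x) (v := v)] at h3
  rw [G.dist_comm (u := u) (v := w)] at hb
  omega

theorem IsTree.not_isLeaf_of_side (hG : G.IsTree) {u v x : V} (huv : G.Adj u v)
    (hx : G.dist x u < G.dist x v) (hne : x ≠ u) : ¬ IsLeaf G u := by
  obtain ⟨z, hz, hd⟩ := hG.connected.exists_adj_dist_succ hne.symm
  refine not_isLeaf_of_adj_of_adj huv hz ?_
  rintro rfl
  omega

variable [Fintype V]

open Classical in
/-- The vertices on the side of `u` with respect to the edge `u v`. -/
noncomputable def side (G : SimpleGraph V) (u v : V) : Finset V :=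
  univ.filter fun w => G.dist w u < G.dist w v

open Classical in
/-- The leaves on the side of `u` with respect to the edge `u v`. -/
noncomputable def sideLeaves (G : SimpleGraph V) (u v : V) : Finset V :=
  univ.filter fun w => IsLeaf G w ∧ G.dist w u < G.dist w v

theorem mem_side {u v w : V} : w ∈ side G u v ↔ G.dist w u < G.dist w v := by
  simp [side]

theorem mem_sideLeaves {u v w : V} :
    w ∈ sideLeaves G u v ↔ IsLeaf G w ∧ G.dist w u < G.dist w v := by
  simp [sideLeaves]

theorem IsTree.card_side_add (hG : G.IsTree) {u v : V} (huv : G.Adj u v) :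
    (side G u v).card + (side G v u).card = Fintype.card V := by
  classical
  rw [← card_union_of_disjoint]
  · rw [← card_univ]
    congr 1
    ext w
    simpa [mem_side] using hG.dist_lt_or_lt huv w
  · rw [Finset.disjoint_left]
    intro w h1 h2
    rw [mem_side] at h1 h2
    omega

/-- The geodesics from `u` to the leaves on its side cover that side. -/
theorem IsTree.card_side_le (hG : G.IsTree) {u v : V} (huv : G.Adj u v) :
    (side G u v).card ≤ 1 + ∑ x ∈ sideLeaves G u v, G.dist u x := by
  classical
  let P : V → Finset V := fun x =>
    univ.filter fun w => w ≠ u ∧ G.dist u w + G.dist w x = G.dist u x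
  have hsub : side G u v ⊆ {u} ∪ (sideLeaves G u v).biUnion P := by
    intro w hw
    rw [mem_side] at hw
    by_cases hwu : w = u
    · simp [hwu]
    · obtain ⟨x, hx, hb⟩ := hG.exists_isLeaf_between hwu
      refine mem_union_right _ (mem_biUnion.mpr ⟨x, ?_, by simp [P, hwu, hb]⟩)
      exact mem_sideLeaves.mpr ⟨hx, hG.dist_lt_of_between_of_ne huv hw hwu hb⟩
  refine (card_le_card hsub).trans ((card_union_le _ _).trans ?_)
  rw [card_singleton]
  refine Nat.add_le_add_left (card_biUnion_le.trans (sum_le_sum fun x _ => ?_)) 1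
  have h : (P x).card ≤ (Icc 1 (G.dist u x)).card := by
    refine card_le_card_of_injOn (fun w => G.dist u w) (fun w hw => ?_) fun w hw w' hw' h => ?_
    · obtain ⟨h1, h2⟩ := (mem_filter.mp hw).2
      have := hG.connected.pos_dist_of_ne h1.symm
      exact mem_Icc.mpr ⟨this, by simp only; omega⟩
    · exact hG.eq_of_between h (mem_filter.mp hw).2.2 (mem_filter.mp hw').2.2
  simpa using h

/-- The geodesic from `u` to `x` contains no leaf other than `x`, so the remaining leaves are
counted in addition to it. -/
theorem IsTree.le_card_side (hG : G.IsTree) {u v x : V} (huv : G.Adj u v)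
    (hx : G.dist x u < G.dist x v) (hne : x ≠ u) [DecidableEq V] :
    G.dist u x + 1 + ((sideLeaves G u v).erase x).card ≤ (side G u v).card := by
  let P : Finset V := univ.filter fun w => G.dist u w + G.dist w x = G.dist u x
  have hP : G.dist u x + 1 ≤ P.card := by
    have : range (G.dist u x + 1) ⊆ P.image (fun w => G.dist u w) := by
      intro k hk
      obtain ⟨w, h1, h2⟩ := hG.connected.exists_between (Nat.lt_succ_iff.mp (mem_range.mp hk))
      exact mem_image.mpr ⟨w, mem_filter.mpr ⟨mem_univ _, by omega⟩, h1⟩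
    simpa using (card_le_card this).trans card_image_le
  have hdisj : Disjoint P ((sideLeaves G u v).erase x) := by
    rw [Finset.disjoint_left]
    intro w h1 h2
    obtain ⟨h3, h4⟩ := mem_erase.mp h2
    have hl := (mem_sideLeaves.mp h4).1
    by_cases hwu : w = u
    · exact hG.not_isLeaf_of_side huv hx hne (hwu ▸ hl)
    · exact hG.connected.not_isLeaf_of_between hwu h3 (mem_filter.mp h1).2 hl
  have hsub : P ∪ (sideLeaves G u v).erase x ⊆ side G u v := by
    intro w hw
    rcases mem_union.mp hw with hw | hw
    · exact mem_side.mpr (hG.dist_lt_of_between huv hx (mem_filter.mp hw).2)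
    · exact mem_side.mpr (mem_sideLeaves.mp (mem_of_mem_erase hw)).2
  have := card_le_card hsub
  rw [card_union_of_disjoint hdisj] at this
  omega

/-- Arm lengths on one side of an edge whose total is the number of vertices on that side. -/
theorem IsTree.exists_armLengths (hG : G.IsTree) {u v x : V} (huv : G.Adj u v)
    (hx : x ∈ sideLeaves G u v) (hne : x ≠ u) :
    ∃ ℓ : V → ℕ, (∀ w ∈ sideLeaves G u v, 1 ≤ ℓ w ∧ ℓ w ≤ G.dist u w) ∧ ℓ x = G.dist u x ∧
      1 + ∑ w ∈ sideLeaves G u v, ℓ w = (side G u v).card := by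
  classical
  have hx' := (mem_sideLeaves.mp hx).2
  have h1 := hG.card_side_le huv
  have h2 := hG.le_card_side huv hx' hne
  rw [← add_sum_erase _ _ hx] at h1
  have hpos : ∀ w ∈ sideLeaves G u v, 1 ≤ G.dist u w := fun w hw =>
    hG.connected.pos_dist_of_ne fun h =>
      hG.not_isLeaf_of_side huv hx' hne (h ▸ (mem_sideLeaves.mp hw).1)
  -- The centre and the full depth of `x` are reserved; the other arms share the remaining vertices.
  obtain ⟨ℓ, hℓ, hsum⟩ := exists_sum_eq_of_le ((sideLeaves G u v).erase x) (fun w => G.dist u w)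
    (N := (side G u v).card - 1 - G.dist u x) (fun w hw => hpos w (mem_of_mem_erase hw))
    (by omega) (by omega)
  refine ⟨Function.update ℓ x (G.dist u x), fun w hw => ?_, Function.update_self _ _ _, ?_⟩
  · by_cases hwx : w = x
    · subst hwx
      rw [Function.update_self]
      exact ⟨hpos w hw, le_rfl⟩
    · rw [Function.update_of_ne hwx]
      exact hℓ w (mem_erase.mpr ⟨hwx, hw⟩)
  · rw [← add_sum_erase _ _ hx, Function.update_self, sum_congr rfl fun w hw =>
      Function.update_of_ne (ne_of_mem_erase hw) _ _, hsum]
    omega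

/-- Take the middle edge of a diametral path. A vertex deeper than `r` on one side would lie too far
from the opposite end of the path. -/
theorem IsTree.exists_central_edge (hG : G.IsTree) {r : ℕ} (hd : G.diam = 2 * r + 1) :
    ∃ u v x y, G.Adj u v ∧ x ∈ sideLeaves G u v ∧ y ∈ sideLeaves G v u ∧
      G.dist u x = r ∧ G.dist v y = r ∧ (∀ w ∈ side G u v, G.dist u w ≤ r) ∧
      ∀ w ∈ side G v u, G.dist v w ≤ r := by
  have := hG.connected.nonempty
  have hle : ∀ a b, G.dist a b ≤ 2 * r + 1 := fun a b =>
    hd ▸ dist_le_diam (connected_iff_ediam_ne_top.mp hG.connected)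
  obtain ⟨x, y, hxy⟩ := G.exists_dist_eq_diam
  have hne : x ≠ y := by rintro rfl; rw [dist_self] at hxy; omega
  have hlx := hG.isLeaf_of_dist_eq_diam hne hxy
  have hly := hG.isLeaf_of_dist_eq_diam hne.symm (by rw [dist_comm, hxy])
  rw [hd] at hxy
  obtain ⟨u, hu1, hu2⟩ := hG.connected.exists_between (G := G) (u := x) (x := y) (k := r) (by omega)
  have huy : u ≠ y := by rintro rfl; omega
  obtain ⟨v, huv, hv⟩ := hG.connected.exists_adj_dist_succ huy
  have e1 := G.dist_comm (u := u) (v := y)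
  have e2 := G.dist_comm (u := u) (v := x)
  have e3 := G.dist_comm (u := v) (v := y)
  have h1 := hG.connected.dist_triangle (u := x) (v := v) (w := y)
  have hx : G.dist x u < G.dist x v := by omega
  have hy : G.dist y v < G.dist y u := by omega
  refine ⟨u, v, x, y, huv, mem_sideLeaves.mpr ⟨hlx, hx⟩, mem_sideLeaves.mpr ⟨hly, hy⟩, by omega,
    by omega, fun w hw => ?_, fun w hw => ?_⟩
  · have h2 := hG.dist_of_opposite huv (mem_side.mp hw) hy
    have := hle w y
    rw [dist_comm]
    omega
  · have h2 := hG.dist_of_opposite huv hx (mem_side.mp hw)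
    have := hle x w
    omega

theorem IsTree.isTwoCentred (hG : G.IsTree) {u v : V} (huv : G.Adj u v)
    (hX : (sideLeaves G u v).Nonempty) (hY : (sideLeaves G v u).Nonempty) {k : V → ℕ}
    (hkX : ∀ x ∈ sideLeaves G u v, k x = G.dist u x)
    (hkY : ∀ y ∈ sideLeaves G v u, k y = G.dist v y) :
    IsTwoCentred G (sideLeaves G u v) (sideLeaves G v u) k := by
  refine ⟨?_, hX, hY, fun x hx x' hx' => ?_, fun y hy y' hy' => ?_, fun x hx y hy => ?_⟩
  · rw [Finset.disjoint_left]
    intro w h1 h2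
    have := (mem_sideLeaves.mp h1).2
    have := (mem_sideLeaves.mp h2).2
    omega
  · rw [hkX x hx, hkX x' hx', G.dist_comm (u := u) (v := x)]
    exact hG.connected.dist_triangle
  · rw [hkY y hy, hkY y' hy', G.dist_comm (u := v) (v := y)]
    exact hG.connected.dist_triangle
  · rw [hkX x hx, hkY y hy, G.dist_comm (u := u) (v := x)]
    exact hG.dist_of_opposite huv (mem_sideLeaves.mp hx).2 (mem_sideLeaves.mp hy).2

/-- Without branching away from the ends of an edge, a tree is a double spider. -/
theorem IsTree.isDoubleSpider_of_dist (hG : G.IsTree) {u v : V} (huv : G.Adj u v)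
    (hX : (sideLeaves G u v).Nonempty) (hY : (sideLeaves G v u).Nonempty)
    (hu : ¬ IsLeaf G u) (hv : ¬ IsLeaf G v)
    (hdX : ∀ x ∈ sideLeaves G u v, ∀ x' ∈ sideLeaves G u v, x ≠ x' →
      G.dist u x + G.dist u x' ≤ G.dist x x')
    (hdY : ∀ y ∈ sideLeaves G v u, ∀ y' ∈ sideLeaves G v u, y ≠ y' →
      G.dist v y + G.dist v y' ≤ G.dist y y') : IsDoubleSpider G := by
  have key : ∀ u v : V, G.Adj u v → (sideLeaves G u v).Nonempty → ¬ IsLeaf G u →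
      (∀ x ∈ sideLeaves G u v, ∀ x' ∈ sideLeaves G u v, x ≠ x' →
        G.dist u x + G.dist u x' ≤ G.dist x x') →
      ∃ (p : ℕ) (a : Fin (p + 1) → ℕ) (φ : SpiderVertex a → V), IsArmProfile a ∧ φ none = u ∧
        Function.Injective φ ∧ (∀ v w, (spider a).Adj v w → G.Adj (φ v) (φ w)) ∧
        Set.range φ = side G u v := by
    intro u v huv hX hu hd
    obtain ⟨p, e, he⟩ := exists_antitone_enumeration hX fun w => G.dist u w
    obtain ⟨φ, h0, hinj, hadj, hrange⟩ := hG.exists_spider_map (u := u)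
      (x := fun i => (e i : V)) (ℓ := fun i => G.dist u (e i)) (fun i => rfl)
      (fun i j hij => hd _ (e i).2 _ (e j).2 fun heq => hij (e.injective (Subtype.ext heq)))
    refine ⟨p, _, φ, ⟨he, fun i => ?_⟩, h0, hinj, hadj, ?_⟩
    · exact hG.connected.pos_dist_of_ne fun heq => hu (heq ▸ (mem_sideLeaves.mp (e i).2).1)
    · ext w
      rw [hrange, mem_coe, mem_side]
      constructor
      · rintro (rfl | ⟨i, hi⟩)
        · rw [dist_self, dist_eq_one_iff_adj.mpr huv]
          exact one_pos
        · exact hG.dist_lt_of_between huv (mem_sideLeaves.mp (e i).2).2 hi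
      · intro hw
        by_cases hwu : w = u
        · exact .inl hwu
        · obtain ⟨x, hx, hb⟩ := hG.exists_isLeaf_between hwu
          have hx' : x ∈ sideLeaves G u v :=
            mem_sideLeaves.mpr ⟨hx, hG.dist_lt_of_between_of_ne huv hw hwu hb⟩
          exact .inr ⟨e.symm ⟨x, hx'⟩, by simpa using hb⟩
  obtain ⟨p, a, φ, ha, hφ0, hφi, hφa, hφr⟩ := key u v huv hX hu hdX
  obtain ⟨q, b, ψ, hb, hψ0, hψi, hψa, hψr⟩ := key v u huv.symm hY hv hdY
  refine ⟨p, q, a, b, ha, hb, hG.nonempty_iso_of_bijective doubleSpider_connected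
    (φ := Sum.elim φ ψ) ⟨?_, ?_⟩ ?_⟩
  · refine hφi.sumElim hψi fun s t h => ?_
    have h1 : φ s ∈ (side G u v : Set V) := hφr ▸ Set.mem_range_self s
    have h2 : ψ t ∈ (side G v u : Set V) := hψr ▸ Set.mem_range_self t
    rw [mem_coe, mem_side] at h1 h2
    rw [h] at h1
    omega
  · intro w
    rcases hG.dist_lt_or_lt huv w with hw | hw
    · have h1 : w ∈ Set.range φ := by rw [hφr]; exact mem_side.mpr hw
      obtain ⟨s, rfl⟩ := h1
      exact ⟨.inl s, rfl⟩
    · have h1 : w ∈ Set.range ψ := by rw [hψr]; exact mem_side.mpr hw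
      obtain ⟨s, rfl⟩ := h1
      exact ⟨.inr s, rfl⟩
  · intro s t h
    exact doubleSpider_adj_induction (P := fun s t => G.Adj (Sum.elim φ ψ s) (Sum.elim φ ψ t))
      (fun _ _ h => h.symm) hφa hψa (by simpa [hφ0, hψ0] using huv) h

/-- With a single leaf beyond `v` and no branching away from `u`, a tree is a spider. -/
theorem IsTree.isSpider_of_card_eq_one (hG : G.IsTree) {u v : V} (huv : G.Adj u v)
    (hu : ¬ IsLeaf G u) (hY : (sideLeaves G v u).card = 1)
    (hdX : ∀ x ∈ sideLeaves G u v, ∀ x' ∈ sideLeaves G u v, x ≠ x' →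
      G.dist u x + G.dist u x' ≤ G.dist x x') : IsSpider G := by
  -- The edge `uv` is absorbed into the single leg through `v`, so `u` becomes the only centre.
  have hcross : ∀ x ∈ sideLeaves G u v, ∀ y ∈ sideLeaves G v u,
      G.dist u x + G.dist u y ≤ G.dist x y := by
    intro x hx y hy
    have h1 := hG.dist_of_opposite huv (mem_sideLeaves.mp hx).2 (mem_sideLeaves.mp hy).2
    have h2 := hG.connected.dist_le_succ_of_adj y huv.symm
    rw [G.dist_comm (u := u) (v := x), G.dist_comm (u := u) (v := y)]
    rw [G.dist_comm (u := v) (v := y)] at h1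
    omega
  refine hG.isSpider_of_dist hu fun x y hx hy hne => ?_
  rcases hG.dist_lt_or_lt huv x with hxs | hxs <;> rcases hG.dist_lt_or_lt huv y with hys | hys
  · exact hdX x (mem_sideLeaves.mpr ⟨hx, hxs⟩) y (mem_sideLeaves.mpr ⟨hy, hys⟩) hne
  · exact hcross x (mem_sideLeaves.mpr ⟨hx, hxs⟩) y (mem_sideLeaves.mpr ⟨hy, hys⟩)
  · rw [add_comm, G.dist_comm (u := x)]
    exact hcross y (mem_sideLeaves.mpr ⟨hy, hys⟩) x (mem_sideLeaves.mpr ⟨hx, hxs⟩)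
  · exact absurd (card_le_one.mp hY.le x (mem_sideLeaves.mpr ⟨hx, hxs⟩) y
      (mem_sideLeaves.mpr ⟨hy, hys⟩)) hne

end SimpleGraph

/-! ### The central edge and strict improvement of trees that are not spiders. -/

namespace SimpleGraph

variable {V : Type*} [Fintype V] {G : SimpleGraph V}

/-- A central edge `u v` of a tree of diameter `2 * r + 1`, with arm lengths `ℓ` of a double spider
of the same order that are at most the depths `k` of the leaves. -/
structure IsCentralEdge (G : SimpleGraph V) (r : ℕ) (u v : V) (k ℓ : V → ℕ) : Prop where
  adj : G.Adj u v
  left_nonleaf : ¬ IsLeaf G u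
  right_nonleaf : ¬ IsLeaf G v
  left_depth : ∀ x ∈ sideLeaves G u v, k x = G.dist u x
  right_depth : ∀ y ∈ sideLeaves G v u, k y = G.dist v y
  left_length : ∀ x ∈ sideLeaves G u v, 1 ≤ ℓ x ∧ ℓ x ≤ r
  right_length : ∀ y ∈ sideLeaves G v u, 1 ≤ ℓ y ∧ ℓ y ≤ r
  length_le : ∀ w, w ∈ sideLeaves G u v ∨ w ∈ sideLeaves G v u → ℓ w ≤ k w
  left_max : ∃ x ∈ sideLeaves G u v, ℓ x = r
  right_max : ∃ y ∈ sideLeaves G v u, ℓ y = r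
  card_eq : (1 + ∑ x ∈ sideLeaves G u v, ℓ x) + (1 + ∑ y ∈ sideLeaves G v u, ℓ y) = Fintype.card V

theorem IsTree.exists_isCentralEdge (hG : G.IsTree) {r : ℕ} (hr : 1 ≤ r)
    (hd : G.diam = 2 * r + 1) : ∃ u v k ℓ, IsCentralEdge G r u v k ℓ := by
  classical
  obtain ⟨u, v, x, y, huv, hx, hy, hxr, hyr, hU, hW⟩ := hG.exists_central_edge hd
  have hxu : x ≠ u := by rintro rfl; rw [dist_self] at hxr; omega
  have hyv : y ≠ v := by rintro rfl; rw [dist_self] at hyr; omega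
  obtain ⟨ℓ₁, h1, h1x, h1s⟩ := hG.exists_armLengths huv hx hxu
  obtain ⟨ℓ₂, h2, h2y, h2s⟩ := hG.exists_armLengths huv.symm hy hyv
  let k : V → ℕ := fun w => if w ∈ side G u v then G.dist u w else G.dist v w
  let ℓ : V → ℕ := fun w => if w ∈ side G u v then ℓ₁ w else ℓ₂ w
  have hXs : ∀ w ∈ sideLeaves G u v, w ∈ side G u v := fun w hw =>
    mem_side.mpr (mem_sideLeaves.mp hw).2
  have hYs' : ∀ w ∈ sideLeaves G v u, w ∈ side G v u := fun w hw =>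
    mem_side.mpr (mem_sideLeaves.mp hw).2
  have hYs : ∀ w ∈ sideLeaves G v u, w ∉ side G u v := fun w hw => by
    have := (mem_sideLeaves.mp hw).2
    rw [mem_side]
    omega
  have kX : ∀ w ∈ sideLeaves G u v, k w = G.dist u w := fun w hw => if_pos (hXs w hw)
  have kY : ∀ w ∈ sideLeaves G v u, k w = G.dist v w := fun w hw => if_neg (hYs w hw)
  have lX : ∀ w ∈ sideLeaves G u v, ℓ w = ℓ₁ w := fun w hw => if_pos (hXs w hw)
  have lY : ∀ w ∈ sideLeaves G v u, ℓ w = ℓ₂ w := fun w hw => if_neg (hYs w hw)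
  refine ⟨u, v, k, ℓ, huv, hG.not_isLeaf_of_side huv (mem_sideLeaves.mp hx).2 hxu,
    hG.not_isLeaf_of_side huv.symm (mem_sideLeaves.mp hy).2 hyv, kX, kY, ?_, ?_, ?_,
    ⟨x, hx, by rw [lX x hx, h1x, hxr]⟩, ⟨y, hy, by rw [lY y hy, h2y, hyr]⟩, ?_⟩
  · intro w hw
    rw [lX w hw]
    exact ⟨(h1 w hw).1, (h1 w hw).2.trans (hU w (hXs w hw))⟩
  · intro w hw
    rw [lY w hw]
    exact ⟨(h2 w hw).1, (h2 w hw).2.trans (hW w (hYs' w hw))⟩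
  · rintro w (hw | hw)
    · rw [lX w hw, kX w hw]
      exact (h1 w hw).2
    · rw [lY w hw, kY w hw]
      exact (h2 w hw).2
  · rw [sum_congr rfl lX, sum_congr rfl lY, h1s, h2s, hG.card_side_add huv]

variable {r : ℕ} {u v : V} {k ℓ : V → ℕ}

/-- No two leaves on the same side of `u v` have a common ancestor other than `u` or `v`. -/
def IsUnbranched (G : SimpleGraph V) (u v : V) : Prop :=
  (∀ x ∈ sideLeaves G u v, ∀ x' ∈ sideLeaves G u v, x ≠ x' →
    G.dist u x + G.dist u x' ≤ G.dist x x') ∧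
  ∀ y ∈ sideLeaves G v u, ∀ y' ∈ sideLeaves G v u, y ≠ y' →
    G.dist v y + G.dist v y' ≤ G.dist y y'

theorem IsCentralEdge.isTwoCentred (h : IsCentralEdge G r u v k ℓ) (hG : G.IsTree) :
    IsTwoCentred G (sideLeaves G u v) (sideLeaves G v u) k :=
  hG.isTwoCentred h.adj (let ⟨x, hx, _⟩ := h.left_max; ⟨x, hx⟩)
    (let ⟨y, hy, _⟩ := h.right_max; ⟨y, hy⟩) h.left_depth h.right_depth

theorem IsCentralEdge.exists_isSecularRoot (h : IsCentralEdge G r u v k ℓ) :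
    ∃ μ : ℝ, IsSecularRoot (sideLeaves G u v) (sideLeaves G v u) ℓ μ :=
  let ⟨μ, _, hμ⟩ := SimpleGraph.exists_isSecularRoot (fun x hx => (h.left_length x hx).2)
    (fun y hy => (h.right_length y hy).2) h.left_max h.right_max
  ⟨μ, hμ⟩

theorem IsCentralEdge.steklovLambda₂_le (h : IsCentralEdge G r u v k ℓ) (hG : G.IsTree) {μ : ℝ}
    (hμ : IsSecularRoot (sideLeaves G u v) (sideLeaves G v u) ℓ μ) : steklovLambda₂ G ≤ μ⁻¹ :=
  (h.isTwoCentred hG).steklovLambda₂_le hG (fun _ hx => (mem_sideLeaves.mp hx).1)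
    (fun _ hy => (mem_sideLeaves.mp hy).1) h.length_le hμ

theorem IsCentralEdge.steklovLambda₂_lt (h : IsCentralEdge G r u v k ℓ) (hG : G.IsTree) {μ : ℝ}
    (hμ : IsSecularRoot (sideLeaves G u v) (sideLeaves G v u) ℓ μ) (hb : ¬ IsUnbranched G u v) :
    steklovLambda₂ G < μ⁻¹ := by
  refine (h.isTwoCentred hG).steklovLambda₂_lt hG (fun _ hx => (mem_sideLeaves.mp hx).1)
    (fun _ hy => (mem_sideLeaves.mp hy).1) h.length_le hμ ?_
  rw [IsUnbranched, not_and_or] at hb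
  rcases hb with hb | hb
  · push Not at hb
    obtain ⟨x, hx, x', hx', hne, hlt⟩ := hb
    exact ⟨x, x', hne, .inl ⟨hx, hx'⟩, by rwa [h.left_depth x hx, h.left_depth x' hx']⟩
  · push Not at hb
    obtain ⟨y, hy, y', hy', hne, hlt⟩ := hb
    exact ⟨y, y', hne, .inr ⟨hy, hy'⟩, by rwa [h.right_depth y hy, h.right_depth y' hy']⟩

theorem IsCentralEdge.isDoubleSpider (h : IsCentralEdge G r u v k ℓ) (hG : G.IsTree)
    (hb : IsUnbranched G u v) : IsDoubleSpider G :=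
  hG.isDoubleSpider_of_dist h.adj (h.isTwoCentred hG).nonempty_left
    (h.isTwoCentred hG).nonempty_right h.left_nonleaf h.right_nonleaf hb.1 hb.2

/-- A tree of odd diameter that is not a spider has strictly smaller `λ₂` than some double spider
of the same order and diameter. -/
theorem IsTree.exists_doubleSpider_lt (hG : G.IsTree) (hr : 1 ≤ r) (hd : G.diam = 2 * r + 1)
    (hs : ¬ IsSpider G) : ∃ (p q : ℕ) (a : Fin (p + 1) → ℕ) (b : Fin (q + 1) → ℕ),
      IsArmProfile a ∧ IsArmProfile b ∧
      Fintype.card (SpiderVertex a ⊕ SpiderVertex b) = Fintype.card V ∧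
      (doubleSpider a b).diam = 2 * r + 1 ∧
      steklovLambda₂ G < steklovLambda₂ (doubleSpider a b) := by
  classical
  obtain ⟨u, v, k, ℓ, h⟩ := hG.exists_isCentralEdge hr hd
  obtain ⟨μ, hμ⟩ := h.exists_isSecularRoot
  by_cases hb : IsUnbranched G u v
  · have hXY := h.isTwoCentred hG
    have hXc : 2 ≤ (sideLeaves G u v).card := by
      by_contra hlt
      have := card_pos.mpr hXY.nonempty_left
      exact hs (hG.isSpider_of_card_eq_one h.adj.symm h.right_nonleaf (by omega) hb.2)
    have hYc : 2 ≤ (sideLeaves G v u).card := by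
      by_contra hlt
      have := card_pos.mpr hXY.nonempty_right
      exact hs (hG.isSpider_of_card_eq_one h.adj h.left_nonleaf (by omega) hb.1)
    obtain ⟨x0, hx0, hx0r⟩ := h.left_max
    obtain ⟨y0, hy0, hy0r⟩ := h.right_max
    -- The competitor keeps the same arms but attaches all of them except `y0` at `u`. The arms `x0`
    -- and `y0` of length `r` preserve the diameter.
    have hX' : ∀ x ∈ sideLeaves G u v ∪ (sideLeaves G v u).erase y0, 1 ≤ ℓ x ∧ ℓ x ≤ r := by
      intro x hx
      rcases mem_union.mp hx with hx | hx
      · exact h.left_length x hx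
      · exact h.right_length x (mem_of_mem_erase hx)
    have hY' : ∀ y ∈ ({y0} : Finset V), 1 ≤ ℓ y ∧ ℓ y ≤ r := by
      intro y hy
      rw [mem_singleton.mp hy]
      exact h.right_length y0 hy0
    have hXr : ∃ x ∈ sideLeaves G u v ∪ (sideLeaves G v u).erase y0, ℓ x = r :=
      ⟨x0, mem_union_left _ hx0, hx0r⟩
    have hYr : ∃ y ∈ ({y0} : Finset V), ℓ y = r := ⟨y0, mem_singleton_self _, hy0r⟩
    obtain ⟨μ', -, hμ'⟩ := SimpleGraph.exists_isSecularRoot (fun x hx => (hX' x hx).2)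
      (fun y hy => (hY' y hy).2) hXr hYr
    obtain ⟨p, q, a, b, ha, hbp, -, -, -, -, hcard, hdiam, hlow⟩ :=
      _root_.exists_doubleSpider hX' hY' hXr hYr
    refine ⟨p, q, a, b, ha, hbp, ?_, hdiam, ?_⟩
    · rw [hcard, ← h.card_eq, sum_union (disjoint_of_subset_right (erase_subset _ _) hXY.disjoint),
        sum_singleton, ← add_sum_erase _ _ hy0]
      ring
    · have hlt := hμ.lt_of_transfer hXY.disjoint hXc hYc ⟨x0, hx0, hx0r.trans hy0r.symm⟩ hy0 hμ'
      have hpos : 0 < μ' := hμ'.pos ⟨x0, mem_union_left _ hx0⟩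
      exact (h.steklovLambda₂_le hG hμ).trans_lt
        ((inv_strictAnti₀ hpos hlt).trans_le (hlow μ' hμ'))
  · obtain ⟨p, q, a, b, ha, hbp, -, -, -, -, hcard, hdiam, hlow⟩ :=
      _root_.exists_doubleSpider h.left_length h.right_length h.left_max h.right_max
    exact ⟨p, q, a, b, ha, hbp, hcard.trans h.card_eq, hdiam,
      (h.steklovLambda₂_lt hG hμ hb).trans_le (hlow μ hμ)⟩

theorem IsTree.exists_doubleSpider_ge (hG : G.IsTree) (hr : 1 ≤ r) (hd : G.diam = 2 * r + 1) :
    ∃ (p q : ℕ) (a : Fin (p + 1) → ℕ) (b : Fin (q + 1) → ℕ),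
      IsArmProfile a ∧ IsArmProfile b ∧
      a 0 = r ∧ b 0 = r ∧ (∀ i, a i ≤ r) ∧ (∀ j, b j ≤ r) ∧
      Fintype.card (SpiderVertex a ⊕ SpiderVertex b) = Fintype.card V ∧
      (doubleSpider a b).diam = 2 * r + 1 ∧
      steklovLambda₂ G ≤ steklovLambda₂ (doubleSpider a b) ∧
      (steklovLambda₂ G = steklovLambda₂ (doubleSpider a b) → IsDoubleSpider G) := by
  obtain ⟨u, v, k, ℓ, h⟩ := hG.exists_isCentralEdge hr hd
  obtain ⟨μ, hμ⟩ := h.exists_isSecularRoot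
  obtain ⟨p, q, a, b, ha, hb, ha0, hb0, har, hbr, hcard, hdiam, hlow⟩ :=
    _root_.exists_doubleSpider h.left_length h.right_length h.left_max h.right_max
  refine ⟨p, q, a, b, ha, hb, ha0, hb0, har, hbr, hcard.trans h.card_eq, hdiam,
    (h.steklovLambda₂_le hG hμ).trans (hlow μ hμ), fun heq => h.isDoubleSpider hG ?_⟩
  by_contra hbr
  exact ((h.steklovLambda₂_lt hG hμ hbr).trans_le (hlow μ hμ)).ne heq

/-- Pulls the better double spider back to the vertex set `V`, where the maximality hypotheses
apply. -/
theorem IsTree.exists_tree_lt (hG : G.IsTree) (hr : 1 ≤ r) (hd : G.diam = 2 * r + 1)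
    (hs : ¬ IsSpider G) : ∃ G' : SimpleGraph V, IsDoubleSpider G' ∧ G'.IsTree ∧
      G'.diam = 2 * r + 1 ∧ steklovLambda₂ G < steklovLambda₂ G' := by
  obtain ⟨p, q, a, b, ha, hb, hcard, hdiam, hlt⟩ := hG.exists_doubleSpider_lt hr hd hs
  let e : V ≃ SpiderVertex a ⊕ SpiderVertex b := Fintype.equivOfCardEq hcard.symm
  let i : (doubleSpider a b).comap e ≃g doubleSpider a b := SimpleGraph.Iso.comap e _
  have ht : ((doubleSpider a b).comap e).IsTree := i.isTree_iff.mpr doubleSpider_isTree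
  refine ⟨_, ⟨p, q, a, b, ha, hb, ⟨i⟩⟩, ht, ?_, ?_⟩
  · rw [i.diam_eq ht.connected doubleSpider_connected, hdiam]
  · rwa [i.steklovLambda₂_eq]

end SimpleGraph

/-- `V` is a vertex set of order `n`, so that the graphs on `V` are, up to isomorphism, all graphs
of order `n`; the diameter is `2 * r + 1`. -/
theorem theorem1p3 {V : Type*} [Fintype V] (r n : ℕ) (hr : 1 ≤ r) (hn : 2 * r + 2 ≤ n)
    (hV : Fintype.card V = n) :
    -- every tree is dominated by a double spider of the same order and diameter, with rigidity
    (∀ T : SimpleGraph V, T.IsTree → T.diam = 2 * r + 1 →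
      ∃ (p q : ℕ) (a : Fin (p + 1) → ℕ) (b : Fin (q + 1) → ℕ),
        IsArmProfile a ∧ IsArmProfile b ∧
        a 0 = r ∧ b 0 = r ∧ (∀ i, a i ≤ r) ∧ (∀ j, b j ≤ r) ∧
        Fintype.card (SpiderVertex a ⊕ SpiderVertex b) = n ∧
        (doubleSpider a b).diam = 2 * r + 1 ∧
        steklovLambda₂ T ≤ steklovLambda₂ (doubleSpider a b) ∧
        (steklovLambda₂ T = steklovLambda₂ (doubleSpider a b) → IsDoubleSpider T)) ∧
    -- every extremal double spider is a spider
    (∀ T : SimpleGraph V, IsDoubleSpider T → T.diam = 2 * r + 1 →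
      (∀ T' : SimpleGraph V, IsDoubleSpider T' → T'.diam = 2 * r + 1 →
        steklovLambda₂ T' ≤ steklovLambda₂ T) →
      IsSpider T) ∧
    -- every extremizer among all trees is a spider
    (∀ T : SimpleGraph V, T.IsTree → T.diam = 2 * r + 1 →
      (∀ T' : SimpleGraph V, T'.IsTree → T'.diam = 2 * r + 1 →
        steklovLambda₂ T' ≤ steklovLambda₂ T) →
      IsSpider T) := by
  subst hV
  refine ⟨fun T hT hd => hT.exists_doubleSpider_ge hr hd, fun T hT hd hmax => ?_,
    fun T hT hd hmax => ?_⟩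
  · have htree : T.IsTree := by
      obtain ⟨p, q, a, b, -, -, ⟨e⟩⟩ := hT
      exact e.isTree_iff.mpr doubleSpider_isTree
    by_contra hs
    obtain ⟨T', h1, -, h2, hlt⟩ := htree.exists_tree_lt hr hd hs
    exact hlt.not_ge (hmax T' h1 h2)
  · by_contra hs
    obtain ⟨T', -, h1, h2, hlt⟩ := hT.exists_tree_lt hr hd hs
    exact hlt.not_ge (hmax T' h1 h2)
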